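/- All groups are finite, all classes of groups are closed under isomorphism and non-empty, $\pi$ is a set of primes and $\pi'$ is the set of primes not in $\pi$. A formation is a class closed under homomorphic images and subdirect products; it is saturated if $G/\Phi(G)\in\mathfrak{X}$ implies $G\in\mathfrak{X}$. A Fitting class is a class closed under normal subgroups and under products of normal subgroups belonging to it; a Fitting formation is both. For a formation $\mathfrak{X}$, the residual $G^{\mathfrak{X}}$ is the smallest normal subgroup of $G$ with quotient in $\mathfrak{X}$; for a Fitting class $\mathfrak{H}$, the radical $G_{\mathfrak{H}}$ is the largest normal subgroup of $G$ belonging to $\mathfrak{H}$. Put $\mathfrak{X}\circ\mathfrak{F}=\{G: G^{\mathfrak{F}}\in\mathfrak{X}\}$ and $\mathfrak{H}\diamond\mathfrak{X}=\{G: G/G_{\mathfrak{H}}\in\mathfrak{X}\}$. Let $\mathtt{S}\mathfrak{X}$ be the class of groups isomorphic to a subgroup of an $\mathfrak{X}$-group, and $\mathtt{E}\mathfrak{X}$ the class of groups $G$ having a series $1=G_0\unlhd G_1\unlhd\cdots\unlhd G_n=G$ with all factors $G_i/G_{i-1}\in\mathfrak{X}$. Let $\mathfrak{G}_{\pi'}$,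 $\mathfrak{N}$, $\mathfrak{N}_\pi$, $\mathfrak{S}_\pi$ be the classes of $\pi'$-groups, nilpotent groups, $\pi$-nilpotent groups (groups with a normal $\pi'$-subgroup with nilpotent quotient), and $\pi$-solvable groups (groups with a subnormal series each of whose factors is a $\pi'$-group or a $p$-group for some $p\in\pi$). Let $\mathfrak{H}\diamond\mathfrak{N}\circ\mathfrak{F}$ denote $\mathfrak{H}\diamond(\mathfrak{N}\circ\mathfrak{F})$. A formation $\mathfrak{F}$ satisfies the $\pi$-boundary condition (I) if every group that is not in $\mathfrak{F}$ but all of whose proper subgroups are in $\mathfrak{F}$ belongs to $\mathfrak{N}_\pi\circ\mathfrak{F}$. Let $$\mathcal{N}_{\mathfrak{H},\mathfrak{F}}(G)=\bigcap_{H\le G}N_G(H^{\mathfrak{F}}G_{\mathfrak{H}}),$$ let $\mathcal{N}^0_{\mathfrak{H},\mathfrak{F}}(G)=1$ and $\mathcal{N}^{i}_{\mathfrak{H},\mathfrak{F}}(G)/\mathcal{N}^{i-1}_{\mathfrak{H},\mathfrak{F}}(G)=\mathcal{N}_{\mathfrak{H},\mathfrak{F}}(G/\mathcal{N}^{i-1}_{\mathfrak{H},\mathfrak{F}}(G))$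 for $i\ge 1$, and let $\mathcal{N}^\infty_{\mathfrak{H},\mathfrak{F}}(G)$ be the terminal term of this ascending series. **Theorem A.** Let $\mathfrak{H}$ be a saturated Fitting formation with $\mathfrak{G}_{\pi'}\subseteq\mathfrak{H}=\mathtt{E}\mathfrak{H}$, let $\mathfrak{F}$ be a formation with $\mathfrak{F}=\mathtt{S}\mathfrak{F}$, and let $G$ be a group. Suppose that (i) $G^{\mathfrak{H}\diamond\mathfrak{N}\circ\mathfrak{F}}\in\mathfrak{S}_\pi$, or (ii) $\mathfrak{F}$ satisfies the $\pi$-boundary condition (I). Then the following statements are equivalent: 1. $G\in\mathfrak{H}\diamond\mathfrak{N}\circ\mathfrak{F}$. 2. $G/\mathcal{N}_{\mathfrak{H},\mathfrak{F}}(G)\in\mathfrak{H}\diamond\mathfrak{N}\circ\mathfrak{F}$. 3. $G/\mathcal{N}^\infty_{\mathfrak{H},\mathfrak{F}}(G)\in\mathfrak{H}\diamond\mathfrak{N}\circ\mathfrak{F}$. 4. $\mathcal{N}_{\mathfrak{H},\mathfrak{F}}(G/N)>1$ for every proper normal subgroup $N$ of $G$. 5. $G=\mathcal{N}^\infty_{\mathfrak{H},\mathfrak{F}}(G)$.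 -/

import Mathlib

universe u

/-- A class of finite groups: an isomorphism-closed property of groups, all of whose members are
finite. -/
@[ext]
structure GroupClass : Type (u + 1) where
  /-- Membership of a group in the class. -/
  Mem : (G : Type u) → [Group G] → Prop
  finite_of_mem : ∀ {G : Type u} [Group G], Mem G → Finite G
  mem_of_mulEquiv : ∀ {G K : Type u} [Group G] [Group K], G ≃* K → Mem G → Mem K

namespace GroupClass

/-- Inclusion of classes. -/
instance : LE GroupClass.{u} where
  le X Y := ∀ (G : Type u) [Group G], X.Mem G → Y.Mem G

/-! ### Residuals, radicals, norms -/

/-- The `X`-residual of `G`: the intersection of all normal subgroups `N` of `G` with `G ⧸ N` in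
`X`. If `X` is a formation and `G` is finite, it is the smallest such `N`. -/
def residual (X : GroupClass.{u}) (G : Type u) [Group G] : Subgroup G :=
  sInf {N | ∃ _ : N.Normal, X.Mem (G ⧸ N)}

/-- The `X`-radical of `G`: the join of all normal subgroups of `G` that belong to `X`. If `X` is
a Fitting class and `G` is finite, it is the largest normal `X`-subgroup of `G`. -/
def radical (X : GroupClass.{u}) (G : Type u) [Group G] : Subgroup G :=
  sSup {N | N.Normal ∧ X.Mem N}

/-- The norm: the intersection of the normalizers of the products of the `𝔣`-residual of `H`
with the `𝔥`-radical of `G`, where `H` runs over all subgroups of `G`. (The radical is normal, so the join is the product.) -/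
def norm (𝔥 𝔣 : GroupClass.{u}) (G : Type u) [Group G] : Subgroup G :=
  ⨅ H : Subgroup G, Subgroup.normalizer
    (((𝔣.residual H).map H.subtype ⊔ 𝔥.radical G : Subgroup G) : Set G)

theorem map_residual (X : GroupClass.{u}) {G K : Type u} [Group G] [Group K] (e : G ≃* K) :
    (X.residual G).map e.toMonoidHom = X.residual K := by
  have key : ∀ {A B : Type u} [Group A] [Group B] (f : A ≃* B),
      (X.residual A).map f.toMonoidHom ≤ X.residual B := by
    intro A B _ _ f
    refine le_sInf ?_
    rintro N ⟨hN, hX⟩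
    rw [Subgroup.map_le_iff_le_comap]
    refine sInf_le ⟨hN.comap _, ?_⟩
    refine X.mem_of_mulEquiv (QuotientGroup.congr _ N f ?_).symm hX
    exact Subgroup.map_comap_eq_self_of_surjective f.surjective N
  refine le_antisymm (key e) ?_
  intro x hx
  have h := key e.symm ⟨x, hx, rfl⟩
  exact ⟨_, h, e.apply_symm_apply x⟩

theorem map_radical (X : GroupClass.{u}) {G K : Type u} [Group G] [Group K] (e : G ≃* K) :
    (X.radical G).map e.toMonoidHom = X.radical K := by
  have key : ∀ {A B : Type u} [Group A] [Group B] (f : A ≃* B),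
      (X.radical A).map f.toMonoidHom ≤ X.radical B := by
    intro A B _ _ f
    rw [Subgroup.map_le_iff_le_comap]
    refine sSup_le ?_
    rintro N ⟨hN, hX⟩
    rw [← Subgroup.map_le_iff_le_comap]
    exact le_sSup ⟨hN.map _ f.surjective, X.mem_of_mulEquiv (f.subgroupMap N) hX⟩
  refine le_antisymm (key e) ?_
  intro x hx
  have h := key e.symm ⟨x, hx, rfl⟩
  exact ⟨_, h, e.apply_symm_apply x⟩

instance residual_characteristic (X : GroupClass.{u}) (G : Type u) [Group G] :
    (X.residual G).Characteristic :=
  Subgroup.characteristic_iff_map_eq.2 fun e => X.map_residual e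

instance radical_characteristic (X : GroupClass.{u}) (G : Type u) [Group G] :
    (X.radical G).Characteristic :=
  Subgroup.characteristic_iff_map_eq.2 fun e => X.map_radical e

theorem map_residual_subgroup (X : GroupClass.{u}) {G K : Type u} [Group G] [Group K]
    (e : G ≃* K) (H : Subgroup G) :
    ((X.residual H).map H.subtype).map (e : G →* K) =
      (X.residual (H.map (e : G →* K))).map (H.map (e : G →* K)).subtype := by
  rw [← X.map_residual (e.subgroupMap H), Subgroup.map_map, Subgroup.map_map]
  rfl

instance norm_characteristic (𝔥 𝔣 : GroupClass.{u}) (G : Type u) [Group G] :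
    (norm 𝔥 𝔣 G).Characteristic := by
  refine Subgroup.characteristic_iff_map_le.2 fun e => ?_
  change (norm 𝔥 𝔣 G).map (e : G →* G) ≤ _
  refine le_iInf fun H => ?_
  have hH : (H.map (e.symm : G →* G)).map (e : G →* G) = H := by
    rw [Subgroup.map_map]
    ext x
    simp
  have hR : 𝔥.radical G = (𝔥.radical G).map (e : G →* G) := (𝔥.map_radical e).symm
  rw [← hH, ← map_residual_subgroup, hR, ← Subgroup.map_sup]
  exact (Subgroup.map_mono (iInf_le _ (H.map (e.symm : G →* G)))).trans
    (Subgroup.map_equiv_normalizer_eq _ e).le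

/-- The ascending norm series, bundled with normality: it starts at `1`, and its `(i+1)`-st term
modulo its `i`-th term is the norm of the quotient by the `i`-th term. -/
def normSeriesAux (𝔥 𝔣 : GroupClass.{u}) (G : Type u) [Group G] :
    ℕ → {N : Subgroup G // N.Normal}
  | 0 => ⟨⊥, inferInstance⟩
  | i + 1 =>
    haveI := (normSeriesAux 𝔥 𝔣 G i).2
    ⟨(norm 𝔥 𝔣 (G ⧸ (normSeriesAux 𝔥 𝔣 G i).1)).comap
      (QuotientGroup.mk' (normSeriesAux 𝔥 𝔣 G i).1), inferInstance⟩

/-- The `i`-th term of the ascending norm series. -/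
def normSeries (𝔥 𝔣 : GroupClass.{u}) (G : Type u) [Group G] (i : ℕ) : Subgroup G :=
  (normSeriesAux 𝔥 𝔣 G i).1

instance normSeries_normal (𝔥 𝔣 : GroupClass.{u}) (G : Type u) [Group G] (i : ℕ) :
    (normSeries 𝔥 𝔣 G i).Normal :=
  (normSeriesAux 𝔥 𝔣 G i).2

/-- The terminal term of the ascending norm series, as the join of its terms (in a finite group
the ascending series becomes stationary at this subgroup). -/
def normInfty (𝔥 𝔣 : GroupClass.{u}) (G : Type u) [Group G] : Subgroup G :=
  ⨆ i : ℕ, normSeries 𝔥 𝔣 G i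

instance normInfty_normal (𝔥 𝔣 : GroupClass.{u}) (G : Type u) [Group G] :
    (normInfty 𝔥 𝔣 G).Normal :=
  Subgroup.iSup_normal _

/-! ### Products and closures of classes -/

/-- The formation product `X ∘ F`: all finite groups whose `F`-residual is in `X`. -/
def formationProduct (X 𝔣 : GroupClass.{u}) : GroupClass.{u} where
  Mem G _ := Finite G ∧ X.Mem (𝔣.residual G)
  finite_of_mem h := h.1
  mem_of_mulEquiv {G K} _ _ e h := by
    have := h.1
    refine ⟨Finite.of_equiv G e.toEquiv, ?_⟩
    rw [← 𝔣.map_residual e]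
    exact X.mem_of_mulEquiv (e.subgroupMap _) h.2

/-- The Fitting product `H ◇ X`: all finite groups whose quotient by the `H`-radical is in `X`. -/
def fittingProduct (𝔥 X : GroupClass.{u}) : GroupClass.{u} where
  Mem G _ := Finite G ∧ X.Mem (G ⧸ 𝔥.radical G)
  finite_of_mem h := h.1
  mem_of_mulEquiv {G K} _ _ e h := by
    have := h.1
    exact ⟨Finite.of_equiv G e.toEquiv,
      X.mem_of_mulEquiv (QuotientGroup.congr _ _ e (𝔥.map_radical e)) h.2⟩

/-- `S X`: all groups isomorphic to a subgroup of a member of `X`. -/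
def subgroupClosure (X : GroupClass.{u}) : GroupClass.{u} where
  Mem G _ := ∃ (A : Type u) (_ : Group A) (f : G →* A), X.Mem A ∧ Function.Injective f
  finite_of_mem := by
    rintro G _ ⟨A, _, f, hA, hf⟩
    have := X.finite_of_mem hA
    exact Finite.of_injective f hf
  mem_of_mulEquiv := by
    rintro G K _ _ e ⟨A, _, f, hA, hf⟩
    exact ⟨A, _, f.comp e.symm.toMonoidHom, hA, hf.comp e.symm.injective⟩

/-- `E X`: all finite groups `G` with a series `1 = G_0 ⊴ G_1 ⊴ ⋯ ⊴ G_n = G` all of whose factors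
`G_{i+1} / G_i` are in `X`. -/
def extensionClosure (X : GroupClass.{u}) : GroupClass.{u} where
  Mem G _ := Finite G ∧ ∃ (n : ℕ) (s : ℕ → Subgroup G), s 0 = ⊥ ∧ s n = ⊤ ∧
    ∀ i < n, s i ≤ s (i + 1) ∧ ∃ _ : ((s i).subgroupOf (s (i + 1))).Normal,
      X.Mem (s (i + 1) ⧸ (s i).subgroupOf (s (i + 1)))
  finite_of_mem h := h.1
  mem_of_mulEquiv := by
    rintro G K _ _ e ⟨hfin, n, s, h0, hn, hs⟩
    refine ⟨Finite.of_equiv G e.toEquiv, n, fun i => (s i).map e.toMonoidHom, ?_, ?_, ?_⟩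
    · simp [h0]
    · simp only [hn]
      exact Subgroup.map_top_of_surjective _ e.surjective
    · intro i hi
      obtain ⟨hle, hnor, hX⟩ := hs i hi
      have hmap : ((s i).subgroupOf (s (i + 1))).map
          ((e.subgroupMap (s (i + 1))).toMonoidHom) =
          ((s i).map e.toMonoidHom).subgroupOf ((s (i + 1)).map e.toMonoidHom) := by
        ext ⟨y, hy⟩
        simp only [Subgroup.mem_map, Subgroup.mem_subgroupOf]
        constructor
        · rintro ⟨x, hx, hxy⟩
          exact ⟨x, hx, congrArg Subtype.val hxy⟩
        · rintro ⟨x, hx, hxy⟩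
          exact ⟨⟨x, hle hx⟩, hx, Subtype.ext hxy⟩
      have hnor' : (((s i).map e.toMonoidHom).subgroupOf
          ((s (i + 1)).map e.toMonoidHom)).Normal := by
        rw [← hmap]
        exact hnor.map _ (e.subgroupMap (s (i + 1))).surjective
      exact ⟨Subgroup.map_mono hle, hnor',
        X.mem_of_mulEquiv (QuotientGroup.congr _ _ (e.subgroupMap (s (i + 1))) hmap) hX⟩

/-- `Crit_S(X)`: the finite groups that are not in `X` while all their proper subgroups are. -/
def critical (X : GroupClass.{u}) : GroupClass.{u} where
  Mem G _ := Finite G ∧ ¬ X.Mem G ∧ ∀ H : Subgroup G, H ≠ ⊤ → X.Mem H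
  finite_of_mem h := h.1
  mem_of_mulEquiv := by
    rintro G K _ _ e ⟨hfin, hG, hH⟩
    refine ⟨Finite.of_equiv G e.toEquiv, fun h => hG (X.mem_of_mulEquiv e.symm h), ?_⟩
    intro H hne
    refine X.mem_of_mulEquiv (e.symm.subgroupMap H).symm (hH _ fun htop => hne ?_)
    refine eq_top_iff.2 fun x _ => ?_
    have hx : e.symm x ∈ H.map e.symm.toMonoidHom := by
      have : H.map (e.symm : K →* G) = ⊤ := htop
      exact this ▸ Subgroup.mem_top _
    obtain ⟨y, hy, hyx⟩ := hx
    exact e.symm.injective hyx ▸ hy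

/-! ### Properties of classes -/

/-- Formations: non-empty classes closed under homomorphic images and subdirect products. -/
structure IsFormation (X : GroupClass.{u}) : Prop where
  nonempty : ∃ (G : Type u) (_ : Group G), X.Mem G
  image : ∀ {G K : Type u} [Group G] [Group K] (f : G →* K),
    Function.Surjective f → X.Mem G → X.Mem K
  subdirect : ∀ {A B : Type u} [Group A] [Group B] (D : Subgroup (A × B)),
    D.map (MonoidHom.fst A B) = ⊤ → D.map (MonoidHom.snd A B) = ⊤ →
    X.Mem A → X.Mem B → X.Mem D

/-- Saturation: `G` is in the class whenever `G / Φ(G)` is. -/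
def IsSaturated (X : GroupClass.{u}) : Prop :=
  ∀ (G : Type u) [Group G] [Finite G], X.Mem (G ⧸ frattini G) → X.Mem G

/-- Fitting classes: non-empty classes closed under normal subgroups and products of normal
subgroups. -/
structure IsFittingClass (X : GroupClass.{u}) : Prop where
  nonempty : ∃ (G : Type u) (_ : Group G), X.Mem G
  normal : ∀ {G : Type u} [Group G] (N : Subgroup G), N.Normal → X.Mem G → X.Mem N
  sup : ∀ {G : Type u} [Group G] [Finite G] (M N : Subgroup G), M.Normal → N.Normal →
    X.Mem M → X.Mem N → X.Mem (M ⊔ N : Subgroup G)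

/-! ### Particular classes -/

/-- The class of finite nilpotent groups. -/
def nilpotentGroups : GroupClass.{u} where
  Mem G _ := Finite G ∧ Group.IsNilpotent G
  finite_of_mem h := h.1
  mem_of_mulEquiv {G K} _ _ e h := by
    have := h.1
    have := h.2
    exact ⟨Finite.of_equiv G e.toEquiv, Group.nilpotent_of_mulEquiv e⟩

/-- The class of finite `π`-groups: all prime divisors of the order are in `π`. -/
def piGroups (π : Set Nat.Primes) : GroupClass.{u} where
  Mem G _ := Finite G ∧ ∀ p : Nat.Primes, (p : ℕ) ∣ Nat.card G → p ∈ π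
  finite_of_mem h := h.1
  mem_of_mulEquiv {G K} _ _ e h := by
    have := h.1
    refine ⟨Finite.of_equiv G e.toEquiv, fun p hp => h.2 p ?_⟩
    rwa [Nat.card_congr e.toEquiv]

/-- The class of the finite groups that are `π'`-groups or `p`-groups for some `p ∈ π`. -/
def piSolvableFactors (π : Set Nat.Primes) : GroupClass.{u} where
  Mem G _ := Finite G ∧ ((piGroups πᶜ).Mem G ∨ ∃ p ∈ π, IsPGroup (p : ℕ) G)
  finite_of_mem h := h.1
  mem_of_mulEquiv {G K} _ _ e h := by
    have := h.1
    refine ⟨Finite.of_equiv G e.toEquiv, ?_⟩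
    rcases h.2 with h | ⟨p, hp, h⟩
    · exact Or.inl ((piGroups πᶜ).mem_of_mulEquiv e h)
    · exact Or.inr ⟨p, hp, h.of_equiv e⟩

/-- The class of finite `π`-solvable groups: those with a subnormal series each of whose factors is
a `π'`-group or a `p`-group for some `p ∈ π`. -/
def piSolvableGroups (π : Set Nat.Primes) : GroupClass.{u} :=
  extensionClosure (piSolvableFactors π)

/-- The class of finite `π`-nilpotent groups: those with a normal `π'`-subgroup with nilpotent
quotient. -/
def piNilpotentGroups (π : Set Nat.Primes) : GroupClass.{u} where
  Mem G _ := Finite G ∧ ∃ (N : Subgroup G) (_ : N.Normal),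
    (piGroups πᶜ).Mem N ∧ Group.IsNilpotent (G ⧸ N)
  finite_of_mem h := h.1
  mem_of_mulEquiv := by
    rintro G K _ _ e ⟨hfin, N, hN, hπ, hnil⟩
    have hN' : (N.map e.toMonoidHom).Normal := hN.map _ e.surjective
    exact ⟨Finite.of_equiv G e.toEquiv, N.map e.toMonoidHom, hN',
      (piGroups πᶜ).mem_of_mulEquiv (e.subgroupMap N) hπ,
      Group.nilpotent_of_mulEquiv (QuotientGroup.congr N (N.map e.toMonoidHom) e rfl)⟩

/-- The `π`-boundary condition (I): `Crit_S(F) ⊆ N_π ∘ F`. -/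
def PiBoundaryI (π : Set Nat.Primes) (𝔣 : GroupClass.{u}) : Prop :=
  𝔣.critical ≤ (piNilpotentGroups π).formationProduct 𝔣

/-- The class `H ◇ N ∘ F`, that is, `H ◇ (N ∘ F)`. -/
def fittingNilpotentProduct (𝔥 𝔣 : GroupClass.{u}) : GroupClass.{u} :=
  𝔥.fittingProduct (nilpotentGroups.formationProduct 𝔣)

end GroupClass

namespace GroupClass

variable {X : GroupClass.{u}}

/-! ### Formations -/

/-! Write `𝔛` for `𝔥 ◇ (𝔑 ∘ 𝔣)`, which is a formation. Two facts carry the theorem: a nontrivial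
`𝔛`-group has nontrivial norm (`norm_ne_bot`), and `G` is in `𝔛` as soon as `G` modulo its norm is
(`mem_of_quotient_norm_mem`). The rest is bookkeeping with the norm series, whose last term has a
quotient of trivial norm.

For the second fact take a counterexample `G` of least order. The norm behaves well under
epimorphisms, so every proper quotient of `G` is in `𝔛`. Hence the `𝔥`-radical is trivial (`𝔥` is
extension-closed), and a minimal normal subgroup `M` inside the norm is contained in every
nontrivial normal subgroup (`𝔛` is a formation). In particular `M` normalizes the residual `H^𝔣` of
every subgroup `H`.

If `M ≤ Φ(G)`, then `M` is an abelian `q`-group. Were `q` to divide the order of the `𝔥`-radical of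
`G/M`, saturation and extension-closure would put all `q`-groups into `𝔥`, and `M` into the trivial
radical of `G`. So `M` is a normal Hall subgroup of the preimage of that radical. By a Frattini
argument it has there a complement normal in `G`, an `𝔥`-group and so trivial. Thus the radical of
`G/M` is trivial, `(G/M)^𝔣` is nilpotent, and nilpotency lifts through `M ≤ Φ(G)`.

If `M` is not in `Φ(G)`, then `G = HM` for a maximal subgroup `H`. Now `H^𝔣` is normal in `G`
without containing `M`, so it is trivial, `G/M ∈ 𝔣` and `G^𝔣 ≤ M`. Condition (i) or (ii) supplies a
nontrivial normal `π'`-subgroup or `q`-subgroup of `G`; the former would lie in the `𝔥`-radical, so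
`M` is a `q`-group and `G^𝔣` is nilpotent. -/

theorem IsFormation.mem_of_subsingleton (hX : X.IsFormation) (G : Type u) [Group G]
    [Subsingleton G] : X.Mem G := by
  obtain ⟨A, _, hA⟩ := hX.nonempty
  exact hX.image (1 : A →* G) (fun x => ⟨1, Subsingleton.elim _ _⟩) hA

theorem IsFormation.mem_of_ker_inf_le (hX : X.IsFormation) {G A B K : Type u} [Group G] [Group A]
    [Group B] [Group K] (f : G →* A) (g : G →* B) (k : G →* K) (hf : Function.Surjective f)
    (hg : Function.Surjective g) (hk : Function.Surjective k) (h : f.ker ⊓ g.ker ≤ k.ker)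
    (hA : X.Mem A) (hB : X.Mem B) : X.Mem K := by
  have hD : X.Mem (f.prod g).range := by
    refine hX.subdirect _ ?_ ?_ hA hB
    · rw [← MonoidHom.range_comp, MonoidHom.fst_comp_prod, MonoidHom.range_eq_top.2 hf]
    · rw [← MonoidHom.range_comp, MonoidHom.snd_comp_prod, MonoidHom.range_eq_top.2 hg]
  have hQ : X.Mem (G ⧸ (f.prod g).ker) :=
    X.mem_of_mulEquiv (QuotientGroup.quotientKerEquivRange (f.prod g)).symm hD
  refine hX.image (QuotientGroup.lift (f.prod g).ker k ?_) ?_ hQ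
  · intro x hx
    refine h ?_
    simpa [MonoidHom.mem_ker, Prod.ext_iff] using hx
  · exact QuotientGroup.lift_surjective_of_surjective _ _ hk _

theorem IsFormation.mem_of_ker_le (hX : X.IsFormation) {G A K : Type u} [Group G] [Group A]
    [Group K] (f : G →* A) (k : G →* K) (hf : Function.Surjective f) (hk : Function.Surjective k)
    (h : f.ker ≤ k.ker) (hA : X.Mem A) : X.Mem K :=
  hX.mem_of_ker_inf_le f f k hf hf hk (inf_le_left.trans h) hA hA

theorem IsFormation.mem_quotient_residual (hX : X.IsFormation) (G : Type u) [Group G] [Finite G] :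
    X.Mem (G ⧸ X.residual G) := by
  classical
  have hfin : {N : Subgroup G | ∃ _ : N.Normal, X.Mem (G ⧸ N)}.Finite := Set.toFinite _
  have key : ∃ _ : (hfin.toFinset.inf id).Normal, X.Mem (G ⧸ hfin.toFinset.inf id) := by
    refine Finset.inf_induction (p := fun N : Subgroup G => ∃ _ : N.Normal, X.Mem (G ⧸ N)) ?_ ?_ ?_
    · have := QuotientGroup.subsingleton_quotient_top (G := G)
      exact ⟨inferInstance, hX.mem_of_subsingleton _⟩
    · rintro A ⟨hA, hXA⟩ B ⟨hB, hXB⟩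
      refine ⟨inferInstance, hX.mem_of_ker_inf_le (QuotientGroup.mk' A) (QuotientGroup.mk' B)
        (QuotientGroup.mk' (A ⊓ B)) (QuotientGroup.mk'_surjective _)
        (QuotientGroup.mk'_surjective _) (QuotientGroup.mk'_surjective _) ?_ hXA hXB⟩
      simp
    · intro N hN
      exact hfin.mem_toFinset.1 hN
  have he : X.residual G = hfin.toFinset.inf id := by
    rw [residual, Finset.inf_id_eq_sInf, Set.Finite.coe_toFinset]
  obtain ⟨h, h'⟩ := key
  exact X.mem_of_mulEquiv (QuotientGroup.quotientMulEquivOfEq he.symm) h'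

theorem IsFormation.mem_iff_residual_le_ker (hX : X.IsFormation) {G K : Type u} [Group G]
    [Group K] [Finite G] (f : G →* K) (hf : Function.Surjective f) :
    X.Mem K ↔ X.residual G ≤ f.ker := by
  constructor
  · intro h
    exact sInf_le ⟨inferInstance,
      X.mem_of_mulEquiv (QuotientGroup.quotientKerEquivOfSurjective f hf).symm h⟩
  · intro h
    refine hX.mem_of_ker_le (QuotientGroup.mk' (X.residual G)) f
      (QuotientGroup.mk'_surjective _) hf ?_ (hX.mem_quotient_residual G)
    rwa [QuotientGroup.ker_mk']

theorem IsFormation.residual_eq_bot_iff (hX : X.IsFormation) (G : Type u) [Group G] [Finite G] :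
    X.residual G = ⊥ ↔ X.Mem G := by
  rw [hX.mem_iff_residual_le_ker (MonoidHom.id G) Function.surjective_id, MonoidHom.ker_id,
    le_bot_iff]

theorem IsFormation.map_residual_of_surjective (hX : X.IsFormation) {G K : Type u} [Group G]
    [Group K] [Finite G] (f : G →* K) (hf : Function.Surjective f) :
    (X.residual G).map f = X.residual K := by
  have : Finite K := Finite.of_surjective f hf
  apply le_antisymm
  · rw [Subgroup.map_le_iff_le_comap]
    have h := (hX.mem_iff_residual_le_ker ((QuotientGroup.mk' (X.residual K)).comp f)
      ((QuotientGroup.mk'_surjective _).comp hf)).1 (hX.mem_quotient_residual K)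
    rwa [← MonoidHom.comap_ker, QuotientGroup.ker_mk'] at h
  · have hn : ((X.residual G).map f).Normal := Subgroup.Normal.map inferInstance f hf
    have h := (hX.mem_iff_residual_le_ker ((QuotientGroup.mk' ((X.residual G).map f)).comp f)
      ((QuotientGroup.mk'_surjective _).comp hf)).2 (by
        rw [← MonoidHom.comap_ker, QuotientGroup.ker_mk']
        exact Subgroup.le_comap_map _ _)
    have h' := (hX.mem_iff_residual_le_ker (QuotientGroup.mk' ((X.residual G).map f))
      (QuotientGroup.mk'_surjective _)).1 h
    rwa [QuotientGroup.ker_mk'] at h'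

/-- The equation with the closure is how `𝔣 = S𝔣` enters; membership passes to any group that embeds
in a member. -/
theorem mem_of_injective (hS : X = X.subgroupClosure) {A B : Type u} [Group A] [Group B]
    (f : A →* B) (hf : Function.Injective f) (hB : X.Mem B) : X.Mem A := by
  rw [hS]
  exact ⟨B, _, f, hB, hf⟩

theorem IsFormation.map_subtype_residual_le (hX : X.IsFormation) (hS : X = X.subgroupClosure)
    {G : Type u} [Group G] [Finite G] (H : Subgroup G) :
    (X.residual H).map H.subtype ≤ X.residual G := by
  set f : H →* G ⧸ X.residual G := (QuotientGroup.mk' (X.residual G)).comp H.subtype with hf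
  have h : X.Mem f.range :=
    mem_of_injective hS f.range.subtype f.range.subtype_injective (hX.mem_quotient_residual G)
  have h' := (hX.mem_iff_residual_le_ker f.rangeRestrict f.rangeRestrict_surjective).1 h
  rw [MonoidHom.ker_rangeRestrict, hf, ← MonoidHom.comap_ker, QuotientGroup.ker_mk'] at h'
  rwa [Subgroup.map_le_iff_le_comap]

/-- A finite group outside a class contains a subgroup that is critical for the class. -/
theorem exists_critical_subgroup {G : Type u} [Group G] [Finite G] (hG : ¬ X.Mem G) :
    ∃ H : Subgroup G, X.critical.Mem H := by
  have hne : {H : Subgroup G | ¬ X.Mem H}.Nonempty :=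
    ⟨⊤, fun h => hG (X.mem_of_mulEquiv Subgroup.topEquiv h)⟩
  obtain ⟨H, hH, hmin⟩ := Set.Finite.exists_minimal (Set.toFinite _) hne
  refine ⟨H, inferInstance, hH, fun K hK => ?_⟩
  by_contra hK'
  have hle : K.map H.subtype ≤ H := Subgroup.map_subtype_le K
  have h := hmin (y := K.map H.subtype)
    (fun h => hK' (X.mem_of_mulEquiv (K.equivMapOfInjective _ H.subtype_injective).symm h)) hle
  apply hK
  rw [eq_top_iff]
  intro x _
  obtain ⟨y, hy, hyx⟩ := h x.2
  rwa [← Subtype.ext hyx]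

/-! ### Fitting classes -/

theorem IsFittingClass.mem_of_le (hX : X.IsFittingClass) {G : Type u} [Group G] {N M : Subgroup G}
    (hN : N.Normal) (hle : N ≤ M) (hM : X.Mem M) : X.Mem N :=
  X.mem_of_mulEquiv (Subgroup.subgroupOfEquivOfLe hle)
    (hX.normal (N.subgroupOf M) (hN.subgroupOf M) hM)

theorem IsFittingClass.mem_of_subsingleton (hX : X.IsFittingClass) (G : Type u) [Group G]
    [Subsingleton G] : X.Mem G := by
  obtain ⟨A, _, hA⟩ := hX.nonempty
  have h := hX.normal (⊥ : Subgroup A) inferInstance hA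
  have : Unique G := ⟨⟨1⟩, fun _ => Subsingleton.elim _ _⟩
  exact X.mem_of_mulEquiv MulEquiv.ofUnique h

theorem IsFittingClass.radical_mem (hX : X.IsFittingClass) (G : Type u) [Group G] [Finite G] :
    X.Mem (X.radical G) := by
  classical
  have hfin : {N : Subgroup G | N.Normal ∧ X.Mem N}.Finite := Set.toFinite _
  have key : (hfin.toFinset.sup id).Normal ∧ X.Mem (hfin.toFinset.sup id : Subgroup G) := by
    refine Finset.sup_induction (p := fun N : Subgroup G => N.Normal ∧ X.Mem N) ?_ ?_ ?_
    · exact ⟨inferInstance, hX.mem_of_subsingleton _⟩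
    · rintro A ⟨hA, hXA⟩ B ⟨hB, hXB⟩
      exact ⟨inferInstance, hX.sup A B hA hB hXA hXB⟩
    · intro N hN
      exact hfin.mem_toFinset.1 hN
  have he : X.radical G = hfin.toFinset.sup id := by
    rw [radical, Finset.sup_id_eq_sSup, Set.Finite.coe_toFinset]
  rw [he]
  exact key.2

theorem le_radical {G : Type u} [Group G] {N : Subgroup G} (hN : N.Normal) (h : X.Mem N) :
    N ≤ X.radical G :=
  le_sSup ⟨hN, h⟩

/-- The radical of a normal subgroup is contained in the radical of the group. -/
theorem IsFittingClass.map_radical_le (hX : X.IsFittingClass) {G : Type u} [Group G] [Finite G]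
    {N : Subgroup G} (hN : N.Normal) : (X.radical N).map N.subtype ≤ X.radical G :=
  le_radical inferInstance
    (X.mem_of_mulEquiv ((X.radical N).equivMapOfInjective _ N.subtype_injective) (hX.radical_mem N))

/-! ### Extension-closed classes -/

theorem mem_of_extension (hE : X = X.extensionClosure) {G : Type u} [Group G] [Finite G]
    (N : Subgroup G) [N.Normal] (hN : X.Mem N) (hQ : X.Mem (G ⧸ N)) : X.Mem G := by
  rw [hE]
  let s : ℕ → Subgroup G
    | 0 => ⊥
    | 1 => N
    | _ => ⊤
  refine ⟨inferInstance, 2, s, rfl, rfl, ?_⟩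
  intro i hi
  interval_cases i
  · change (⊥ : Subgroup G) ≤ N ∧ ∃ _ : ((⊥ : Subgroup G).subgroupOf N).Normal,
      X.Mem (N ⧸ (⊥ : Subgroup G).subgroupOf N)
    exact ⟨bot_le, inferInstance, X.mem_of_mulEquiv (QuotientGroup.quotientBot.symm.trans
      (QuotientGroup.quotientMulEquivOfEq (Subgroup.bot_subgroupOf N).symm)) hN⟩
  · change N ≤ ⊤ ∧ ∃ _ : (N.subgroupOf ⊤).Normal, X.Mem ((⊤ : Subgroup G) ⧸ N.subgroupOf ⊤)
    refine ⟨le_top, inferInstance,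
      X.mem_of_mulEquiv (QuotientGroup.congr _ _ Subgroup.topEquiv.symm ?_) hQ⟩
    ext ⟨x, hx⟩
    refine ⟨?_, fun h => ⟨x, h, rfl⟩⟩
    rintro ⟨y, hy, h⟩
    obtain rfl : y = x := congrArg Subtype.val h
    exact hy

theorem mem_of_ker_mem (hE : X = X.extensionClosure) {G K : Type u} [Group G] [Group K] [Finite G]
    (f : G →* K) (hf : Function.Surjective f) (hker : X.Mem f.ker) (hK : X.Mem K) : X.Mem G :=
  mem_of_extension hE f.ker hker
    (X.mem_of_mulEquiv (QuotientGroup.quotientKerEquivOfSurjective f hf).symm hK)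

end GroupClass

/-! ### Frattini extensions -/

namespace InducedExtension

variable {L : Type u} [Group L] {C : Type} [CommGroup C] (e : C →* L)

/-- The projection to `L` of the set obtained from `L` by replacing each left coset of `e.range`
with a copy of `C`. -/
noncomputable def proj (ω : (L ⧸ e.range) × C) : L :=
  ω.1.out * e ω.2

theorem proj_surjective : Function.Surjective (proj e) := by
  intro l
  obtain ⟨⟨_, c, rfl⟩, h⟩ := QuotientGroup.mk_out_eq_mul e.range l
  refine ⟨((l : L ⧸ e.range), c⁻¹), ?_⟩
  simp only at h
  simp [proj, h]

theorem proj_eq {ω ω' : (L ⧸ e.range) × C} (h : proj e ω = proj e ω') :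
    ω.1 = ω'.1 ∧ e ω.2 = e ω'.2 := by
  have h1 : ω.1 = ω'.1 := by
    have := congrArg (QuotientGroup.mk : L → L ⧸ e.range) h
    rwa [proj, proj, QuotientGroup.mk_mul_of_mem _ (MonoidHom.mem_range.2 ⟨ω.2, rfl⟩),
      QuotientGroup.mk_mul_of_mem _ (MonoidHom.mem_range.2 ⟨ω'.2, rfl⟩),
      QuotientGroup.out_eq', QuotientGroup.out_eq']
      at this
  refine ⟨h1, ?_⟩
  rw [proj, proj, h1] at h
  exact mul_left_cancel h

/-- The group of all pairs of an element `l` of `L` and a permutation that commutes with `C` and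
lies over the left multiplication by `l`. -/
def total : Subgroup (L × Equiv.Perm ((L ⧸ e.range) × C)) where
  carrier := {y | (∀ ω, proj e (y.2 ω) = y.1 * proj e ω) ∧
    ∀ t c d, y.2 (t, c * d) = ((y.2 (t, c)).1, (y.2 (t, c)).2 * d)}
  one_mem' := by simp
  mul_mem' := by
    rintro ⟨l, σ⟩ ⟨m, τ⟩ ⟨h1, h2⟩ ⟨h3, h4⟩
    refine ⟨fun ω => ?_, fun t c d => ?_⟩
    · simp only at h1 h3
      simp [h1, h3, mul_assoc]
    · simp only at h2 h4
      simp [h4, h2]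
  inv_mem' := by
    rintro ⟨l, σ⟩ ⟨h1, h2⟩
    simp only at h1 h2
    refine ⟨fun ω => ?_, fun t c d => ?_⟩
    · have := h1 (σ⁻¹ ω)
      rw [← Equiv.Perm.mul_apply, mul_inv_cancel, Equiv.Perm.one_apply] at this
      simp [this]
    · simp only [Prod.snd_inv]
      rw [Equiv.Perm.inv_eq_iff_eq, h2]
      simp

/-- The projection of the extension to `L`. -/
def toBase : total e →* L :=
  (MonoidHom.fst _ _).comp (total e).subtype

/-- A lift of `l` may be prescribed freely on the points `(t, 1)`, subject to lying over `l *
t.out`, and then extends uniquely to a map commuting with `C`. -/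
theorem toBase_surjective [Finite L] [Finite C] : Function.Surjective (toBase e) := by
  intro l
  choose ω hω using fun t : L ⧸ e.range => proj_surjective e (l * t.out)
  let σ : (L ⧸ e.range) × C → (L ⧸ e.range) × C := fun y => ((ω y.1).1, (ω y.1).2 * y.2)
  have hσ : ∀ y, proj e (σ y) = l * proj e y := by
    intro y
    have := hω y.1
    simp only [proj] at this
    simp [proj, σ, ← mul_assoc, this]
  have hinj : Function.Injective σ := by
    intro y z h
    have h1 : y.1 = z.1 := by
      have := congrArg (proj e) h
      rw [hσ, hσ] at this
      exact (proj_eq e (mul_left_cancel this)).1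
    have h2 : (ω y.1).2 * y.2 = (ω z.1).2 * z.2 := congrArg Prod.snd h
    rw [h1] at h2
    exact Prod.ext h1 (mul_left_cancel h2)
  refine ⟨⟨(l, Equiv.ofBijective σ (Finite.injective_iff_bijective.1 hinj)), hσ, ?_⟩, rfl⟩
  intro t c d
  simp [σ, mul_assoc]

/-- A permutation commuting with `C` that keeps the block of `t` acts on it as multiplication by one
element `b`, so its powers can be read off from those of `b`. -/
theorem iterate_apply {y : L × Equiv.Perm ((L ⧸ e.range) × C)} (hy : y ∈ total e)
    {t : L ⧸ e.range} {b : C} (h : y.2 (t, 1) = (t, b)) (n : ℕ) (c : C) :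
    (y.2 ^ n) (t, c) = (t, b ^ n * c) := by
  induction n with
  | zero => simp
  | succ n ih =>
    rw [pow_succ', Equiv.Perm.mul_apply, ih, ← one_mul (b ^ n * c), hy.2, h]
    simp [pow_succ', mul_assoc]

theorem pow_eq_one_of_mem_ker {q : ℕ} (hker : ∀ c, e c = 1 → c ^ q = 1) (y : total e)
    (hy : toBase e y = 1) : y ^ q = 1 := by
  obtain ⟨⟨l, σ⟩, hm⟩ := y
  obtain rfl : l = 1 := hy
  have hm' := hm
  obtain ⟨h1, h2⟩ := hm'
  simp only [one_mul] at h1 h2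
  apply Subtype.ext
  refine Prod.ext (by simp) (Equiv.ext ?_)
  rintro ⟨t, c⟩
  obtain ⟨h3, h4⟩ := proj_eq e (h1 (t, 1))
  have h5 : σ (t, 1) = (t, (σ (t, 1)).2) := Prod.ext h3 rfl
  have := iterate_apply e hm h5 q c
  rw [map_one] at h4
  rw [hker _ h4, one_mul] at this
  simpa using this

theorem pow_ne_one_of_toBase_eq {q : ℕ} {c₀ : C} (hc : ∀ c, e c = e c₀ → c ^ q ≠ 1)
    (y : total e) (hy : toBase e y = e c₀) : y ^ q ≠ 1 := by
  obtain ⟨⟨l, σ⟩, hm⟩ := y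
  obtain rfl : l = e c₀ := hy
  have hm' := hm
  obtain ⟨h1, h2⟩ := hm'
  simp only at h1 h2
  intro hq
  set t : L ⧸ e.range := ((1 : L) : L ⧸ e.range) with ht
  obtain ⟨d, hd⟩ : t.out ∈ e.range := by
    have := QuotientGroup.eq.1 ((QuotientGroup.out_eq' t).symm :
      ((1 : L) : L ⧸ e.range) = t.out)
    rwa [inv_one, one_mul] at this
  have h3 : proj e (σ (t, 1)) = proj e (t, c₀) := by
    rw [h1, proj, proj]
    simp only [map_one, mul_one, ← hd, ← map_mul]
    -- Both factors are images of elements of the commutative group `C`; this is why the block of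
    -- the trivial coset is used.
    rw [mul_comm]
  obtain ⟨h4, h5⟩ := proj_eq e h3
  have h6 : σ (t, 1) = (t, (σ (t, 1)).2) := Prod.ext h4 rfl
  have h7 := iterate_apply e hm h6 q 1
  have h8 : σ ^ q = 1 := congrArg Prod.snd (congrArg Subtype.val hq)
  rw [h8, mul_one, Equiv.Perm.one_apply] at h7
  exact hc _ h5 (congrArg Prod.snd h7).symm

end InducedExtension

/-- Every element `x` of prime order `q` of a finite group is the image of no element of order `q`
under a suitable epimorphism from a finite group whose kernel has exponent `q`. -/
theorem exists_extension_pow_ne_one {L : Type u} [Group L] [Finite L] {q : ℕ} [hq : Fact q.Prime]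
    {x : L} (hx : orderOf x = q) :
    ∃ (E : Type u) (_ : Group E) (_ : Finite E) (f : E →* L), Function.Surjective f ∧
      (∀ y, f y = 1 → y ^ q = 1) ∧ ∀ y, f y = x → y ^ q ≠ 1 := by
  have hq0 : q ≠ 0 := hq.out.ne_zero
  have : NeZero (q ^ 2) := ⟨pow_ne_zero 2 hq0⟩
  have hpow : ∀ m, x ^ (m % q ^ 2) = x ^ m := by
    intro m
    rw [pow_eq_pow_iff_modEq, hx]
    exact (Nat.mod_modEq m (q ^ 2)).of_dvd (dvd_pow_self q two_ne_zero)
  -- The cyclic group of order `q ^ 2` covers `⟨x⟩` with kernel of order `q`, and every preimage of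
  -- `x` is a generator; the induced extension carries this over to `L`.
  let e : Multiplicative (ZMod (q ^ 2)) →* L :=
    { toFun := fun b => x ^ (b.toAdd).val
      map_one' := by simp
      map_mul' := fun a b => by rw [toAdd_mul, ZMod.val_add, hpow, pow_add] }
  have hpw : ∀ b : Multiplicative (ZMod (q ^ 2)), b ^ q = 1 ↔ q ∣ b.toAdd.val := by
    intro b
    rw [← toAdd_eq_zero, toAdd_pow]
    generalize b.toAdd = a
    rw [← Nat.mul_dvd_mul_iff_left (c := a.val) hq.out.pos]
    conv_lhs => rw [← ZMod.natCast_zmod_val a, nsmul_eq_mul, ← Nat.cast_mul,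
      ZMod.natCast_eq_zero_iff]
    generalize a.val = v
    rw [pow_two]
  have hxd : ∀ m, q ∣ m ↔ x ^ m = 1 := fun m => by rw [← hx, orderOf_dvd_iff_pow_eq_one]
  have he : ∀ b, e b = x ^ (b.toAdd).val := fun _ => rfl
  have hone : 1 < q ^ 2 := one_lt_pow₀ hq.out.one_lt two_ne_zero
  have : Fact (1 < q ^ 2) := ⟨hone⟩
  have hx1 : e (Multiplicative.ofAdd 1) = x := by
    rw [he, toAdd_ofAdd, ZMod.val_one, pow_one]
  refine ⟨InducedExtension.total e, inferInstance, inferInstance, InducedExtension.toBase e,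
    InducedExtension.toBase_surjective e,
    fun y hy => InducedExtension.pow_eq_one_of_mem_ker e (fun c hc => ?_) y hy,
    fun y hy => InducedExtension.pow_ne_one_of_toBase_eq e (c₀ := Multiplicative.ofAdd 1)
      (fun c hc => ?_) y (hy.trans hx1.symm)⟩
  · rw [hpw, hxd]
    exact hc
  · rw [Ne, hpw, hxd]
    intro h
    rw [hx1, he, h] at hc
    rw [← hc, orderOf_one] at hx
    exact hq.out.ne_one hx.symm

/-- A minimal supplement of the kernel meets it inside its Frattini subgroup. -/
theorem exists_subgroup_ker_le_frattini {E L : Type*} [Group E] [Finite E] [Group L] (f : E →* L)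
    (hf : Function.Surjective f) :
    ∃ U : Subgroup E, Function.Surjective (f.comp U.subtype) ∧
      (f.comp U.subtype).ker ≤ frattini U := by
  have hne : {U : Subgroup E | U.map f = ⊤}.Nonempty :=
    ⟨⊤, Subgroup.map_top_of_surjective f hf⟩
  obtain ⟨U, hU, hmin⟩ := Set.Finite.exists_minimal (Set.toFinite _) hne
  have hs : Function.Surjective (f.comp U.subtype) := by
    rw [← MonoidHom.range_eq_top, MonoidHom.range_comp, Subgroup.range_subtype]
    exact hU
  refine ⟨U, hs, ?_⟩
  rw [frattini, Order.radical]
  refine le_iInf₂ fun V hV => ?_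
  -- A maximal subgroup of `U` not containing the kernel would supplement it in `U`, giving a
  -- smaller supplement in `E`.
  by_contra hle
  have hsup : V ⊔ (f.comp U.subtype).ker = ⊤ := hV.2 _ (left_lt_sup.2 hle)
  have hmap : V.map (f.comp U.subtype) = ⊤ := by
    rw [← Subgroup.map_top_of_surjective _ hs, ← hsup, Subgroup.map_sup,
      (Subgroup.map_eq_bot_iff _).2 le_rfl, sup_bot_eq]
  have h := hmin (y := V.map U.subtype) (by
    change (V.map U.subtype).map f = ⊤
    rwa [Subgroup.map_map]) (Subgroup.map_subtype_le V)
  apply hV.1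
  rw [eq_top_iff]
  intro x _
  obtain ⟨y, hy, hyx⟩ := h x.2
  rwa [← Subtype.ext hyx]

/-! ### The `q`-groups in a saturated extension-closed Fitting formation -/

namespace GroupClass

variable {X : GroupClass.{u}}

/-- Cover `L` by a group `U` whose kernel has exponent dividing `q` and lies in `Φ(U)`. Saturation
puts `U` in the class, hence also the kernel, as a normal subgroup. The kernel is nontrivial because
an element of order `q` in `L` has no lift `u` with `u ^ q = 1`. -/
theorem exists_nontrivial_pGroup_mem (hF : X.IsFormation) (hX : X.IsFittingClass)
    (hsat : X.IsSaturated) {L : Type u} [Group L] (hL : X.Mem L) {q : ℕ} [hq : Fact q.Prime]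
    (hdvd : q ∣ Nat.card L) :
    ∃ (B : Type u) (_ : Group B), Nontrivial B ∧ X.Mem B ∧ IsPGroup q B := by
  have : Finite L := X.finite_of_mem hL
  obtain ⟨x, hx⟩ := exists_prime_orderOf_dvd_card' q hdvd
  obtain ⟨E, _, _, f, hf, hker, hlift⟩ := exists_extension_pow_ne_one hx
  obtain ⟨U, hU, hfr⟩ := exists_subgroup_ker_le_frattini f hf
  have hUX : X.Mem U := by
    refine hsat U (hF.mem_of_ker_le (f.comp U.subtype) (QuotientGroup.mk' (frattini U)) hU
      (QuotientGroup.mk'_surjective _) ?_ hL)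
    rwa [QuotientGroup.ker_mk']
  obtain ⟨u, hu⟩ := hU x
  refine ⟨(f.comp U.subtype).ker, inferInstance, ?_, hX.normal _ inferInstance hUX, ?_⟩
  · rw [Subgroup.nontrivial_iff_exists_ne_one]
    refine ⟨u ^ q, ?_, fun h => hlift u hu ?_⟩
    · rw [MonoidHom.mem_ker, map_pow, hu, ← hx, pow_orderOf_eq_one]
    · simpa using congrArg Subtype.val h
  · rintro ⟨y, hy⟩
    refine ⟨1, ?_⟩
    have := hker y hy
    apply Subtype.ext
    apply Subtype.ext
    simpa using this

/-- A central subgroup of order `q` of the given member shows that the group of order `q` is in the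
class; every `q`-group is built from it by central extensions. -/
theorem mem_of_isPGroup_of_exists (hX : X.IsFittingClass) (hE : X = X.extensionClosure) {q : ℕ}
    [hq : Fact q.Prime] (h : ∃ (B : Type u) (_ : Group B), Nontrivial B ∧ X.Mem B ∧ IsPGroup q B)
    (P : Type u) [Group P] [Finite P] (hP : IsPGroup q P) : X.Mem P := by
  have hcentral : ∀ (B : Type u) [Group B] [Finite B] [Nontrivial B], IsPGroup q B →
      ∃ Z : Subgroup B, Z.Normal ∧ Nat.card Z = q := by
    intro B _ _ _ hB
    have := hB.center_nontrivial
    have hc := (hB.to_subgroup (Subgroup.center B)).card_eq_or_dvd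
    obtain ⟨z, hz⟩ := exists_prime_orderOf_dvd_card' (G := Subgroup.center B) q
      (hc.resolve_left Finite.one_lt_card.ne')
    refine ⟨Subgroup.zpowers (z : B), ⟨fun n hn g => ?_⟩, ?_⟩
    · have hn' : n ∈ Subgroup.center B := Subgroup.zpowers_le.2 z.2 hn
      rwa [Subgroup.mem_center_iff.1 hn' g, mul_inv_cancel_right]
    · rw [Nat.card_zpowers, Subgroup.orderOf_coe, hz]
  obtain ⟨B, _, hBn, hBX, hB⟩ := h
  have := X.finite_of_mem hBX
  obtain ⟨Z, hZ, hZc⟩ := hcentral B hB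
  have hZX : X.Mem Z := hX.normal Z hZ hBX
  induction hn : Nat.card P using Nat.strong_induction_on generalizing P with
  | _ n ih =>
    rcases subsingleton_or_nontrivial P with hs | hs
    · exact hX.mem_of_subsingleton P
    · obtain ⟨W, hW, hWc⟩ := hcentral P hP
      have hWX : X.Mem W := by
        have : IsCyclic W := isCyclic_of_prime_card hWc
        have : IsCyclic Z := isCyclic_of_prime_card hZc
        exact X.mem_of_mulEquiv (mulEquivOfCyclicCardEq (hZc.trans hWc.symm)) hZX
      refine mem_of_extension hE W hWX (ih _ ?_ (P ⧸ W) (hP.to_quotient W) rfl)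
      rw [← hn, ← W.card_mul_index, hWc, ← Subgroup.index_eq_card]
      exact lt_mul_of_one_lt_left (Nat.pos_of_ne_zero W.index_ne_zero_of_finite) hq.out.one_lt

/-- A saturated Fitting formation closed under extensions that has a member of order divisible
by `q` contains all `q`-groups. -/
theorem mem_of_isPGroup_of_dvd (hF : X.IsFormation) (hX : X.IsFittingClass)
    (hsat : X.IsSaturated) (hE : X = X.extensionClosure) {L : Type u} [Group L] (hL : X.Mem L)
    {q : ℕ} [Fact q.Prime] (hdvd : q ∣ Nat.card L) (P : Type u) [Group P] [Finite P]
    (hP : IsPGroup q P) : X.Mem P :=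
  mem_of_isPGroup_of_exists hX hE (exists_nontrivial_pGroup_mem hF hX hsat hL hdvd) P hP

end GroupClass

/-! ### Consequences of the Frattini argument -/

theorem isNilpotent_iff_forall_sylow_normal {G : Type*} [Group G] [Finite G] :
    Group.IsNilpotent G ↔
      ∀ (p : ℕ) (_ : Fact p.Prime) (P : Sylow p G), (P : Subgroup G).Normal := by
  have h := (Group.isNilpotent_of_finite_tfae (G := G)).out 0 3
  exact h

/-- A normal subgroup that is nilpotent modulo a subgroup of the Frattini subgroup is nilpotent. -/
theorem isNilpotent_of_map_mk_of_le_frattini {G : Type*} [Group G] [Finite G] (D M : Subgroup G)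
    [D.Normal] [M.Normal] (hM : M ≤ frattini G)
    (h : Group.IsNilpotent (D.map (QuotientGroup.mk' M))) : Group.IsNilpotent D := by
  rw [isNilpotent_iff_forall_sylow_normal]
  intro p hp P
  have hS := isNilpotent_iff_forall_sylow_normal.1 h p hp
    (P.mapSurjective ((QuotientGroup.mk' M).subgroupMap_surjective D))
  have hchar := Sylow.characteristic_of_normal _ hS
  have hDn : (D.map (QuotientGroup.mk' M)).Normal :=
    Subgroup.Normal.map inferInstance _ (QuotientGroup.mk'_surjective M)
  set P' : Subgroup G := (P : Subgroup D).map D.subtype with hP'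
  have hT : (P'.map (QuotientGroup.mk' M)).Normal := by
    have h1 : ((P.mapSurjective ((QuotientGroup.mk' M).subgroupMap_surjective D) :
        Subgroup _).map (D.map (QuotientGroup.mk' M)).subtype).Normal := inferInstance
    rw [Sylow.coe_mapSurjective, Subgroup.map_map] at h1
    rw [hP', Subgroup.map_map]
    exact h1
  have hTn : (P' ⊔ M).Normal := by
    have := hT.comap (QuotientGroup.mk' M)
    rwa [Subgroup.comap_map_eq, QuotientGroup.ker_mk'] at this
  have hP'D : P' ≤ D := Subgroup.map_subtype_le _
  -- The Frattini argument is run in `P'M ∩ D`, which is normal in `G`: there `P'` is a Sylow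
  -- subgroup, whereas in `P'M` it need not be one.
  let i : ↥((P' ⊔ M) ⊓ D) →* D := Subgroup.inclusion inf_le_right
  have hrange : (P : Subgroup D) ≤ i.range := by
    intro x hx
    refine ⟨⟨x, ?_, x.2⟩, rfl⟩
    exact (le_sup_left : P' ≤ _) ⟨x, hx, rfl⟩
  have hfr := Sylow.normalizer_sup_eq_top
    (P.comapOfInjective i (Subgroup.inclusion_injective _) hrange)
  have hmap : ((P.comapOfInjective i (Subgroup.inclusion_injective _) hrange : Subgroup _)).map
      ((P' ⊔ M) ⊓ D).subtype = P' := by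
    rw [Sylow.coe_comapOfInjective]
    ext x
    constructor
    · rintro ⟨y, hy, rfl⟩
      exact ⟨i y, hy, rfl⟩
    · rintro ⟨y, hy, rfl⟩
      obtain ⟨z, rfl⟩ := hrange hy
      exact ⟨z, hy, rfl⟩
  rw [hmap] at hfr
  have htop : Subgroup.normalizer (P' : Set G) ⊔ frattini G = ⊤ := by
    rw [eq_top_iff, ← hfr]
    refine sup_le le_sup_left (inf_le_left.trans (sup_le ?_ (hM.trans le_sup_right)))
    exact Subgroup.le_normalizer.trans le_sup_left
  have hn : P'.Normal := Subgroup.normalizer_eq_top_iff.1 (frattini_nongenerating htop)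
  exact hn.of_map_subtype

/-- Complements of an abelian normal Hall subgroup are conjugate. -/
theorem exists_conj_eq_of_isComplement' {G : Type*} [Group G] [Finite G] {H K K' : Subgroup G}
    [IsMulCommutative H] [H.Normal] (hH : (Nat.card H).Coprime H.index)
    (hK : Subgroup.IsComplement' H K) (hK' : Subgroup.IsComplement' H K') :
    ∃ h ∈ H, K.map (MulAut.conj h).toMonoidHom = K' := by
  -- `H` is transitive on `H.QuotientDiff`, so it is enough that each complement is a point
  -- stabilizer: it fixes its own class as a transversal, and the stabilizer, being a complement
  -- too, has the same order.
  have key : ∀ J : Subgroup G, Subgroup.IsComplement' H J →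
      ∃ α : H.QuotientDiff, J = MulAction.stabilizer G α := by
    intro J hJ
    let T : H.LeftTransversal := ⟨J, hJ.symm⟩
    let α : H.QuotientDiff := Quotient.mk'' T
    refine ⟨α, Subgroup.eq_of_le_of_card_ge ?_ ?_⟩
    · intro g hg
      rw [MulAction.mem_stabilizer_iff]
      change (Quotient.mk'' (MulOpposite.op g⁻¹ • T) : H.QuotientDiff) = _
      refine congrArg Quotient.mk'' ?_
      apply Subtype.ext
      open scoped Pointwise in
      change MulOpposite.op g⁻¹ • (J : Set G) = J
      exact op_smul_coe_set (J.inv_mem hg)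
    · have h1 := hJ.card_mul_card
      have h2 := (Subgroup.isComplement'_stabilizer_of_coprime
        (α := α) hH).card_mul_card
      exact (Nat.eq_of_mul_eq_mul_left Nat.card_pos (h2.trans h1.symm)).le
  obtain ⟨α, rfl⟩ := key K hK
  obtain ⟨β, rfl⟩ := key K' hK'
  obtain ⟨h, rfl⟩ := Subgroup.exists_smul_eq hH α β
  exact ⟨h, h.2, (MulAction.stabilizer_smul_eq_stabilizer_map_conj (h : G) α).symm⟩

/-- An abelian normal subgroup of `G` that lies in the Frattini subgroup of `G` and is a Hall
subgroup of a normal subgroup `R` of `G` has a complement in `R` that is normal in `G`. -/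
theorem exists_normal_complement_of_le_frattini {G : Type*} [Group G] [Finite G]
    {M R : Subgroup G} [M.Normal] [R.Normal] [IsMulCommutative M] (hMR : M ≤ R)
    (hM : M ≤ frattini G) (hco : (Nat.card M).Coprime (M.relIndex R)) :
    ∃ L : Subgroup G, L.Normal ∧ L ⊓ M = ⊥ ∧ L ⊔ M = R := by
  set N : Subgroup R := M.subgroupOf R with hN
  have hcard : Nat.card N = Nat.card M :=
    Nat.card_congr (Subgroup.subgroupOfEquivOfLe hMR).toEquiv
  have hcoN : (Nat.card N).Coprime N.index := by rwa [hcard]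
  have hcomm : IsMulCommutative N := by
    refine ⟨⟨fun a b => ?_⟩⟩
    have h := mul_comm' (⟨((a : R) : G), a.2⟩ : M) (⟨((b : R) : G), b.2⟩ : M)
    have h' : ((a : R) : G) * ((b : R) : G) = ((b : R) : G) * ((a : R) : G) :=
      congrArg Subtype.val h
    exact Subtype.ext (Subtype.ext h')
  obtain ⟨K, hK⟩ := Subgroup.exists_right_complement'_of_coprime hcoN
  have hmapN : N.map R.subtype = M := by
    rw [hN, Subgroup.subgroupOf_map_subtype, inf_eq_left.2 hMR]
  refine ⟨K.map R.subtype, ?_, ?_, ?_⟩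
  -- Frattini argument with complements in place of Sylow subgroups: each `G`-conjugate of `K` is
  -- already conjugate to it under `M`, so `G = M N_G(K)`, and `M ≤ Φ(G)` can be dropped.
  · rw [← Subgroup.normalizer_eq_top_iff]
    refine frattini_nongenerating ?_
    rw [eq_top_iff]
    intro g _
    have hK' : Subgroup.IsComplement' N (K.map (MulAut.conjNormal g : MulAut R).toMonoidHom) := by
      have hc : Nat.card (K.map (MulAut.conjNormal g : MulAut R).toMonoidHom) = Nat.card K :=
        Nat.card_congr ((MulAut.conjNormal g : MulAut R).subgroupMap K).toEquiv.symm
      refine Subgroup.isComplement'_of_coprime ?_ ?_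
      · rw [hc, hK.card_mul_card]
      · rw [hc, ← hK.symm.index_eq_card]
        exact hcoN
    obtain ⟨h, hhN, hh⟩ := exists_conj_eq_of_isComplement' hcoN hK hK'
    have hn : (h : G)⁻¹ * g ∈ Subgroup.normalizer (K.map R.subtype : Set G) := by
      rw [Subgroup.mem_normalizer_iff_map_conj_eq]
      have h1 := congrArg (Subgroup.map R.subtype) hh
      rw [Subgroup.map_map, Subgroup.map_map] at h1
      have e1 : R.subtype.comp (MulAut.conj h).toMonoidHom =
          (MulAut.conj (h : G)).toMonoidHom.comp R.subtype := by ext; simp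
      have e2 : R.subtype.comp (MulAut.conjNormal g : MulAut R).toMonoidHom =
          (MulAut.conj g).toMonoidHom.comp R.subtype := by ext; simp
      rw [e1, e2, ← Subgroup.map_map, ← Subgroup.map_map] at h1
      have e3 : (MulAut.conj ((h : G)⁻¹ * g)).toMonoidHom =
          (MulAut.conj (h : G)⁻¹).toMonoidHom.comp (MulAut.conj g).toMonoidHom := by
        ext; simp [mul_assoc]
      have e4 : (MulAut.conj (h : G)⁻¹).toMonoidHom.comp (MulAut.conj (h : G)).toMonoidHom =
          MonoidHom.id G := by ext; simp [mul_assoc]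
      change (K.map R.subtype).map (MulAut.conj ((h : G)⁻¹ * g)).toMonoidHom = _
      rw [e3, ← Subgroup.map_map, ← h1]
      exact (Subgroup.map_map _ _ _).trans (by rw [e4, Subgroup.map_id])
    have hg : g = (h : G) * ((h : G)⁻¹ * g) := by group
    rw [hg]
    exact mul_mem (Subgroup.mem_sup_right (hM hhN)) (Subgroup.mem_sup_left hn)
  · rw [← hmapN, ← Subgroup.map_inf _ _ _ R.subtype_injective, hK.symm.disjoint.eq_bot,
      Subgroup.map_bot]
  · rw [← hmapN, ← Subgroup.map_sup, hK.symm.sup_eq_top, ← MonoidHom.range_eq_map,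
      Subgroup.range_subtype]

namespace GroupClass

/-! ### Groups with a nontrivial normal `π'`-subgroup or `q`-subgroup -/

theorem piGroups_isFittingClass (π : Set Nat.Primes) :
    (piGroups.{u} π).IsFittingClass where
  nonempty := ⟨PUnit, inferInstance, inferInstance, fun p hp => by
    rw [Nat.card_unique, Nat.dvd_one] at hp
    exact absurd hp p.2.ne_one⟩
  normal N _ h := by
    have := h.1
    exact ⟨inferInstance, fun p hp => h.2 p (hp.trans N.card_subgroup_dvd_card)⟩
  sup M N hM hN h1 h2 := by
    refine ⟨inferInstance, fun p hp => ?_⟩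
    have h : Nat.card (M ⊔ N : Subgroup _) ∣ Nat.card M * Nat.card N := by
      have e := Subgroup.card_mul_index (N.subgroupOf (M ⊔ N))
      rw [← e, mul_comm, Nat.card_congr (Subgroup.subgroupOfEquivOfLe le_sup_right).toEquiv]
      refine mul_dvd_mul_right ?_ _
      change N.relIndex (M ⊔ N) ∣ _
      rw [Subgroup.relIndex_sup_right]
      exact (N.subgroupOf M).index_dvd_card
    rcases (p.2.dvd_mul).1 (hp.trans h) with h | h
    · exact h1.2 p h
    · exact h2.2 p h

theorem piGroups_singleton_mem_iff (q : Nat.Primes) (G : Type u) [Group G] [Finite G] :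
    (piGroups {q}).Mem G ↔ IsPGroup (q : ℕ) G := by
  have : Fact (q : ℕ).Prime := ⟨q.2⟩
  rw [IsPGroup.iff_card]
  constructor
  · rintro ⟨_, h⟩
    refine ⟨_, Nat.eq_prime_pow_of_unique_prime_dvd Nat.card_pos.ne' fun {d} hd hdvd => ?_⟩
    exact congrArg Subtype.val (Set.mem_singleton_iff.1 (h ⟨d, hd⟩ hdvd))
  · rintro ⟨n, hn⟩
    refine ⟨inferInstance, fun p hp => ?_⟩
    rw [hn] at hp
    exact Subtype.ext ((Nat.prime_dvd_prime_iff_eq p.2 q.2).1 (p.2.dvd_of_dvd_pow hp))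

theorem IsFittingClass.radical_ne_bot_of_normal {X : GroupClass.{u}} (hX : X.IsFittingClass)
    {A G : Type u} [Group A] [Group G] [Finite G] {N : Subgroup G} (hN : N.Normal) (e : A ≃* N)
    (h : X.radical A ≠ ⊥) : X.radical G ≠ ⊥ := by
  intro hG
  apply h
  have h1 := hX.map_radical_le hN
  rw [hG, le_bot_iff, Subgroup.map_eq_bot_iff_of_injective _ N.subtype_injective,
    ← X.map_radical e] at h1
  exact (Subgroup.map_eq_bot_iff_of_injective _ e.injective).1 h1

/-- The group has a nontrivial normal `π'`-subgroup or a nontrivial normal `q`-subgroup for some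
prime `q`. -/
def HasLocalRadical (π : Set Nat.Primes) (G : Type u) [Group G] : Prop :=
  (piGroups πᶜ).radical G ≠ ⊥ ∨ ∃ q : Nat.Primes, (piGroups {q}).radical G ≠ ⊥

variable {π : Set Nat.Primes}

/-- Applied repeatedly, this carries the property from a subnormal subgroup up to the whole group;
the isomorphism `e` allows passage between the different types involved. -/
theorem HasLocalRadical.of_normal {A G : Type u} [Group A] [Group G] [Finite G] {N : Subgroup G}
    (hN : N.Normal) (e : A ≃* N) (h : HasLocalRadical π A) : HasLocalRadical π G :=
  h.imp (fun h => (piGroups_isFittingClass _).radical_ne_bot_of_normal hN e h)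
    fun ⟨q, h⟩ => ⟨q, (piGroups_isFittingClass _).radical_ne_bot_of_normal hN e h⟩

theorem radical_ne_bot_of_mem {X : GroupClass.{u}} {G : Type u} [Group G] {N : Subgroup G}
    (hN : N.Normal) (hne : N ≠ ⊥) (h : X.Mem N) : X.radical G ≠ ⊥ :=
  ne_bot_of_le_ne_bot hne (le_radical hN h)

theorem hasLocalRadical_of_piSolvableFactors {G : Type u} [Group G] [Nontrivial G]
    (h : (piSolvableFactors π).Mem G) : HasLocalRadical π G := by
  have := h.1
  rcases h.2 with h | ⟨q, _, h⟩
  · exact Or.inl (radical_ne_bot_of_mem (N := ⊤) inferInstance top_ne_bot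
      (GroupClass.mem_of_mulEquiv _ Subgroup.topEquiv.symm h))
  · exact Or.inr ⟨q, radical_ne_bot_of_mem (N := ⊤) inferInstance top_ne_bot
      ((piGroups_singleton_mem_iff q _).2 (h.of_equiv Subgroup.topEquiv.symm))⟩

theorem hasLocalRadical_of_isNilpotent {G : Type u} [Group G] [Finite G] [Nontrivial G]
    (h : Group.IsNilpotent G) : HasLocalRadical π G := by
  have hq : (Nat.card G).minFac.Prime := Nat.minFac_prime Finite.one_lt_card.ne'
  have : Fact (Nat.card G).minFac.Prime := ⟨hq⟩
  obtain ⟨P⟩ : Nonempty (Sylow (Nat.card G).minFac G) := inferInstance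
  refine Or.inr ⟨⟨_, hq⟩, radical_ne_bot_of_mem (N := P)
    (isNilpotent_iff_forall_sylow_normal.1 h _ inferInstance P)
    (P.ne_bot_of_dvd_card (Nat.minFac_dvd _)) ?_⟩
  exact (piGroups_singleton_mem_iff ⟨_, hq⟩ _).2 P.2

theorem hasLocalRadical_of_piNilpotentGroups {G : Type u} [Group G] [Nontrivial G]
    (h : (piNilpotentGroups π).Mem G) : HasLocalRadical π G := by
  obtain ⟨_, N, hN, hπ, hnil⟩ := h
  by_cases hne : N = ⊥
  · subst hne
    exact hasLocalRadical_of_isNilpotent (Group.nilpotent_of_mulEquiv QuotientGroup.quotientBot)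
  · exact Or.inl (radical_ne_bot_of_mem hN hne hπ)

/-- The first nontrivial term of the series is isomorphic to its factor, a `π'`-group or a
`q`-group; the property then climbs the series. -/
theorem hasLocalRadical_of_piSolvableGroups {G : Type u} [Group G] [Nontrivial G]
    (h : (piSolvableGroups π).Mem G) : HasLocalRadical π G := by
  obtain ⟨_, n, s, h0, hn, hs⟩ := h
  have key : ∀ j ≤ n, s j ≠ ⊥ → HasLocalRadical π (s j) := by
    intro j
    induction j with
    | zero => exact fun _ h => absurd h0 h
    | succ j ih =>
      intro hj hne
      obtain ⟨hle, hnor, hX⟩ := hs j hj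
      by_cases hbot : s j = ⊥
      · have : Nontrivial (s (j + 1)) := (Subgroup.nontrivial_iff_ne_bot _).2 hne
        refine hasLocalRadical_of_piSolvableFactors ((piSolvableFactors π).mem_of_mulEquiv
          ((QuotientGroup.quotientMulEquivOfEq ?_).trans QuotientGroup.quotientBot) hX)
        rw [hbot, Subgroup.bot_subgroupOf]
      · exact (ih (by omega) hbot).of_normal hnor (Subgroup.subgroupOfEquivOfLe hle).symm
  have h := key n le_rfl (by rw [hn]; exact top_ne_bot)
  rw [hn] at h
  exact h.of_normal (N := ⊤) inferInstance (MulEquiv.refl _)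

theorem extensionClosure_image {Y : GroupClass.{u}}
    (hY : ∀ {G K : Type u} [Group G] [Group K] (f : G →* K), Function.Surjective f →
      Y.Mem G → Y.Mem K) {G K : Type u} [Group G] [Group K] (f : G →* K)
    (hf : Function.Surjective f) (hG : Y.extensionClosure.Mem G) : Y.extensionClosure.Mem K := by
  obtain ⟨_, n, s, h0, hn, hs⟩ := hG
  refine ⟨Finite.of_surjective f hf, n, fun i => (s i).map f, by simp [h0], ?_, fun i hi => ?_⟩
  · simp only [hn]
    exact Subgroup.map_top_of_surjective f hf
  obtain ⟨hle, hnor, hX⟩ := hs i hi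
  have hmap : ((s i).subgroupOf (s (i + 1))).map (f.subgroupMap (s (i + 1))) =
      ((s i).map f).subgroupOf ((s (i + 1)).map f) := by
    ext ⟨y, hy⟩
    simp only [Subgroup.mem_map, Subgroup.mem_subgroupOf]
    constructor
    · rintro ⟨x, hx, hxy⟩
      exact ⟨x, hx, congrArg Subtype.val hxy⟩
    · rintro ⟨x, hx, hxy⟩
      exact ⟨⟨x, hle hx⟩, hx, Subtype.ext hxy⟩
  have hnor' : (((s i).map f).subgroupOf ((s (i + 1)).map f)).Normal := by
    rw [← hmap]
    exact hnor.map _ (f.subgroupMap_surjective _)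
  refine ⟨Subgroup.map_mono hle, hnor', hY (QuotientGroup.map _ _ (f.subgroupMap (s (i + 1)))
    (Subgroup.map_le_iff_le_comap.1 hmap.le)) ?_ hX⟩
  exact QuotientGroup.map_surjective_of_surjective _ _ _
    ((QuotientGroup.mk'_surjective _).comp (f.subgroupMap_surjective _)) _

theorem piSolvableGroups_image {G K : Type u} [Group G] [Group K] (f : G →* K)
    (hf : Function.Surjective f) (hG : (piSolvableGroups π).Mem G) :
    (piSolvableGroups π).Mem K := by
  refine extensionClosure_image (fun {A B} _ _ g hg hA => ?_) f hf hG
  have := hA.1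
  have : Finite B := Finite.of_surjective g hg
  refine ⟨inferInstance, hA.2.imp ?_ ?_⟩
  · exact fun h => ⟨inferInstance,
      fun p hp => h.2 p (hp.trans (Subgroup.card_dvd_of_surjective g hg))⟩
  · exact fun ⟨p, hp, h⟩ => ⟨p, hp, h.of_surjective g hg⟩

end GroupClass

namespace GroupClass

variable {𝔥 𝔣 : GroupClass.{u}}

/-! ### The class `H ◇ N ∘ F` -/

theorem isNilpotent_of_injective {A B : Type*} [Group A] [Group B] [Group.IsNilpotent B]
    (f : A →* B) (hf : Function.Injective f) : Group.IsNilpotent A :=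
  Group.nilpotent_of_mulEquiv (MonoidHom.ofInjective hf).symm

theorem ker_subgroupMap_inf_ker_subgroupMap {G A B : Type*} [Group G] [Group A] [Group B]
    {f : G →* A} {g : G →* B} (h : f.ker ⊓ g.ker = ⊥) (H : Subgroup G) :
    (f.subgroupMap H).ker ⊓ (g.subgroupMap H).ker = ⊥ := by
  rw [Subgroup.ker_subgroupMap, Subgroup.ker_subgroupMap, Subgroup.subgroupOf, Subgroup.subgroupOf,
    ← Subgroup.comap_inf, h]
  exact Subgroup.bot_subgroupOf _

theorem IsFormation.isNilpotent_residual_of_surjective (h𝔣 : 𝔣.IsFormation) {G K : Type u}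
    [Group G] [Group K] [Finite G] (f : G →* K) (hf : Function.Surjective f)
    (h : Group.IsNilpotent (𝔣.residual G)) : Group.IsNilpotent (𝔣.residual K) := by
  rw [← h𝔣.map_residual_of_surjective f hf]
  exact Group.nilpotent_of_surjective _ (f.subgroupMap_surjective _)

/-- The residual of `G` embeds in the product of the residuals of `A` and `B`. -/
theorem IsFormation.isNilpotent_residual_of_ker_inf (h𝔣 : 𝔣.IsFormation) {G A B : Type u}
    [Group G] [Group A] [Group B] [Finite G] (f : G →* A) (g : G →* B)
    (hf : Function.Surjective f) (hg : Function.Surjective g) (hker : f.ker ⊓ g.ker = ⊥)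
    (hA : Group.IsNilpotent (𝔣.residual A)) (hB : Group.IsNilpotent (𝔣.residual B)) :
    Group.IsNilpotent (𝔣.residual G) := by
  rw [← h𝔣.map_residual_of_surjective f hf] at hA
  rw [← h𝔣.map_residual_of_surjective g hg] at hB
  refine isNilpotent_of_injective
    ((f.subgroupMap (𝔣.residual G)).prod (g.subgroupMap (𝔣.residual G))) ?_
  rw [← MonoidHom.ker_eq_bot_iff, MonoidHom.ker_prod]
  exact ker_subgroupMap_inf_ker_subgroupMap hker _

theorem fittingNilpotentProduct_mem_iff (G : Type u) [Group G] [Finite G] :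
    (fittingNilpotentProduct 𝔥 𝔣).Mem G ↔
      Group.IsNilpotent (𝔣.residual (G ⧸ 𝔥.radical G)) :=
  ⟨fun h => h.2.2.2, fun h => ⟨inferInstance, inferInstance, inferInstance, h⟩⟩

/-- The kernel lies in the radical and `𝔑 ∘ 𝔣` is closed under images. Hence membership may be
tested on any normal `𝔥`-subgroup instead of the radical itself. -/
theorem mem_fittingNilpotentProduct_of_ker_mem (h𝔣 : 𝔣.IsFormation) {G K : Type u} [Group G]
    [Group K] [Finite G] (f : G →* K) (hf : Function.Surjective f) (hker : 𝔥.Mem f.ker)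
    (h : Group.IsNilpotent (𝔣.residual K)) : (fittingNilpotentProduct 𝔥 𝔣).Mem G := by
  have : Finite K := Finite.of_surjective f hf
  rw [fittingNilpotentProduct_mem_iff]
  have hle : f.ker ≤ (QuotientGroup.mk' (𝔥.radical G)).ker := by
    rw [QuotientGroup.ker_mk']
    exact le_radical inferInstance hker
  refine h𝔣.isNilpotent_residual_of_surjective
    (f.liftOfSurjective hf ⟨QuotientGroup.mk' (𝔥.radical G), hle⟩) ?_ h
  have hcomp := f.liftOfRightInverse_comp _ (Function.rightInverse_surjInv hf)
    ⟨QuotientGroup.mk' (𝔥.radical G), hle⟩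
  refine Function.Surjective.of_comp (g := f) ?_
  rw [← MonoidHom.coe_comp, hcomp]
  exact QuotientGroup.mk'_surjective _

theorem mem_fittingNilpotentProduct_of_isNilpotent_residual (h𝔥 : 𝔥.IsFittingClass)
    (h𝔣 : 𝔣.IsFormation) {G : Type u} [Group G] [Finite G]
    (h : Group.IsNilpotent (𝔣.residual G)) : (fittingNilpotentProduct 𝔥 𝔣).Mem G := by
  refine mem_fittingNilpotentProduct_of_ker_mem h𝔣 (MonoidHom.id G) Function.surjective_id ?_ h
  rw [MonoidHom.ker_id]
  exact h𝔥.mem_of_subsingleton _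

theorem isNilpotent_residual_of_radical_eq_bot (h𝔣 : 𝔣.IsFormation) {G : Type u} [Group G]
    [Finite G] (hrad : 𝔥.radical G = ⊥) (h : (fittingNilpotentProduct 𝔥 𝔣).Mem G) :
    Group.IsNilpotent (𝔣.residual G) := by
  rw [fittingNilpotentProduct_mem_iff] at h
  refine h𝔣.isNilpotent_residual_of_ker_inf (QuotientGroup.mk' _) (QuotientGroup.mk' _)
    (QuotientGroup.mk'_surjective _) (QuotientGroup.mk'_surjective _) ?_ h h
  rw [QuotientGroup.ker_mk', inf_idem, hrad]

theorem map_radical_le_of_surjective (h𝔥 : 𝔥.IsFormation) (h𝔥' : 𝔥.IsFittingClass) {G K : Type u}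
    [Group G] [Group K] [Finite G] (f : G →* K) (hf : Function.Surjective f) :
    (𝔥.radical G).map f ≤ 𝔥.radical K :=
  le_radical (Subgroup.Normal.map inferInstance f hf)
    (h𝔥.image _ (f.subgroupMap_surjective _) (h𝔥'.radical_mem G))

theorem fittingNilpotentProduct_isFormation (h𝔥 : 𝔥.IsFormation) (h𝔥' : 𝔥.IsFittingClass)
    (h𝔣 : 𝔣.IsFormation) : (fittingNilpotentProduct 𝔥 𝔣).IsFormation where
  nonempty := ⟨PUnit, inferInstance, mem_fittingNilpotentProduct_of_isNilpotent_residual h𝔥' h𝔣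
    inferInstance⟩
  image {G K} _ _ f hf h := by
    have : Finite G := h.1
    have : Finite K := Finite.of_surjective f hf
    rw [fittingNilpotentProduct_mem_iff] at h ⊢
    refine h𝔣.isNilpotent_residual_of_surjective (QuotientGroup.map (𝔥.radical G) (𝔥.radical K) f
      (Subgroup.map_le_iff_le_comap.1 (map_radical_le_of_surjective h𝔥 h𝔥' f hf))) ?_ h
    exact QuotientGroup.map_surjective_of_surjective _ _ _
      ((QuotientGroup.mk'_surjective _).comp hf) _
  subdirect {A B} _ _ D h1 h2 hA hB := by
    have : Finite A := hA.1
    have : Finite B := hB.1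
    rw [fittingNilpotentProduct_mem_iff] at hA hB
    set f : D →* A := (MonoidHom.fst A B).comp D.subtype with hf_def
    set g : D →* B := (MonoidHom.snd A B).comp D.subtype with hg_def
    have hf : Function.Surjective f := by
      rw [← MonoidHom.range_eq_top, hf_def, MonoidHom.range_comp, Subgroup.range_subtype, h1]
    have hg : Function.Surjective g := by
      rw [← MonoidHom.range_eq_top, hg_def, MonoidHom.range_comp, Subgroup.range_subtype, h2]
    have hfg : f.ker ⊓ g.ker = ⊥ := by
      rw [eq_bot_iff]
      rintro x ⟨hx1, hx2⟩
      exact Subtype.ext (Prod.ext hx1 hx2)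
    set f' := (QuotientGroup.mk' (𝔥.radical A)).comp f with hf'_def
    set g' := (QuotientGroup.mk' (𝔥.radical B)).comp g with hg'_def
    have hf' : Function.Surjective f' := (QuotientGroup.mk'_surjective _).comp hf
    have hg' : Function.Surjective g' := (QuotientGroup.mk'_surjective _).comp hg
    -- `R` is a subdirect product of its images in `A` and `B`. These are normal subgroups contained
    -- in the radicals, hence in `𝔥`, so `R ∈ 𝔥`.
    set R := f'.ker ⊓ g'.ker with hR
    have hRf : R.map f ≤ 𝔥.radical A := by
      rw [Subgroup.map_le_iff_le_comap, ← QuotientGroup.ker_mk' (𝔥.radical A),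
        MonoidHom.comap_ker]
      exact inf_le_left
    have hRg : R.map g ≤ 𝔥.radical B := by
      rw [Subgroup.map_le_iff_le_comap, ← QuotientGroup.ker_mk' (𝔥.radical B),
        MonoidHom.comap_ker]
      exact inf_le_right
    have hRmem : 𝔥.Mem R := by
      refine h𝔥.mem_of_ker_inf_le (f.subgroupMap R) (g.subgroupMap R) (MonoidHom.id R)
        (f.subgroupMap_surjective R) (g.subgroupMap_surjective R) Function.surjective_id ?_
        (h𝔥'.mem_of_le (Subgroup.Normal.map inferInstance f hf) hRf (h𝔥'.radical_mem A))
        (h𝔥'.mem_of_le (Subgroup.Normal.map inferInstance g hg) hRg (h𝔥'.radical_mem B))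
      rw [ker_subgroupMap_inf_ker_subgroupMap hfg]
      exact bot_le
    refine mem_fittingNilpotentProduct_of_ker_mem h𝔣 (QuotientGroup.mk' R)
      (QuotientGroup.mk'_surjective _) (by rwa [QuotientGroup.ker_mk']) ?_
    refine h𝔣.isNilpotent_residual_of_ker_inf (QuotientGroup.lift R f' fun x hx => hx.1)
      (QuotientGroup.lift R g' fun x hx => hx.2)
      (QuotientGroup.lift_surjective_of_surjective _ _ hf' _)
      (QuotientGroup.lift_surjective_of_surjective _ _ hg' _) ?_ hA hB
    rw [eq_bot_iff]
    rintro ⟨x⟩ ⟨hx1, hx2⟩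
    exact (QuotientGroup.eq_one_iff x).2 ⟨hx1, hx2⟩

theorem fittingNilpotentProduct_mem_of_extension (h𝔥 : 𝔥.IsFittingClass)
    (hE : 𝔥 = 𝔥.extensionClosure) (h𝔣 : 𝔣.IsFormation) {G : Type u} [Group G] [Finite G]
    (N : Subgroup G) [N.Normal] (hN : 𝔥.Mem N) (h : (fittingNilpotentProduct 𝔥 𝔣).Mem (G ⧸ N)) :
    (fittingNilpotentProduct 𝔥 𝔣).Mem G := by
  rw [fittingNilpotentProduct_mem_iff] at h
  set R := (𝔥.radical (G ⧸ N)).comap (QuotientGroup.mk' N) with hR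
  have hle : N ≤ R := by
    intro x hx
    have : QuotientGroup.mk' N x = 1 := (QuotientGroup.eq_one_iff x).2 hx
    rw [hR, Subgroup.mem_comap, this]
    exact one_mem _
  refine mem_fittingNilpotentProduct_of_ker_mem h𝔣
    ((QuotientGroup.mk' (𝔥.radical (G ⧸ N))).comp (QuotientGroup.mk' N))
    ((QuotientGroup.mk'_surjective _).comp (QuotientGroup.mk'_surjective _)) ?_ h
  rw [← MonoidHom.comap_ker, QuotientGroup.ker_mk', ← hR]
  refine mem_of_ker_mem hE ((QuotientGroup.mk' N).subgroupMap R)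
    ((QuotientGroup.mk' N).subgroupMap_surjective R) ?_ ?_
  · rw [Subgroup.ker_subgroupMap, QuotientGroup.ker_mk']
    exact 𝔥.mem_of_mulEquiv (Subgroup.subgroupOfEquivOfLe hle).symm hN
  · rw [hR, Subgroup.map_comap_eq_self_of_surjective (QuotientGroup.mk'_surjective N)]
    exact h𝔥.radical_mem _

/-! ### The norm -/

theorem map_norm_le (h𝔥 : 𝔥.IsFormation) (h𝔥' : 𝔥.IsFittingClass) (h𝔣 : 𝔣.IsFormation)
    {G K : Type u} [Group G] [Group K] [Finite G] (f : G →* K) (hf : Function.Surjective f) :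
    (norm 𝔥 𝔣 G).map f ≤ norm 𝔥 𝔣 K := by
  refine le_iInf fun H => ?_
  have hH : (H.comap f).map f = H := Subgroup.map_comap_eq_self_of_surjective hf H
  have hres : ((𝔣.residual (H.comap f)).map (H.comap f).subtype).map f =
      (𝔣.residual H).map H.subtype := by
    have h := h𝔣.map_residual_of_surjective (f.subgroupMap (H.comap f))
      (f.subgroupMap_surjective _)
    have h' : ((𝔣.residual (H.comap f)).map (H.comap f).subtype).map f =
        (𝔣.residual ((H.comap f).map f)).map ((H.comap f).map f).subtype := by
      rw [← h, Subgroup.map_map, Subgroup.map_map]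
      rfl
    rw [h', hH]
  rintro _ ⟨x, hx, rfl⟩
  have h1 : f x ∈ Subgroup.normalizer
      (((𝔣.residual H).map H.subtype ⊔ (𝔥.radical G).map f : Subgroup K) : Set K) := by
    rw [← hres, ← Subgroup.map_sup]
    exact Subgroup.le_normalizer_map f ⟨x, Subgroup.mem_iInf.1 hx (H.comap f), rfl⟩
  -- The image of the radical of `G` may be smaller than the radical of `K`; adding the latter is
  -- harmless, as it is normal.
  have h2 : (𝔣.residual H).map H.subtype ⊔ 𝔥.radical K =
      ((𝔣.residual H).map H.subtype ⊔ (𝔥.radical G).map f) ⊔ 𝔥.radical K := by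
    rw [sup_assoc, sup_eq_right.2 (map_radical_le_of_surjective h𝔥 h𝔥' f hf)]
  rw [h2]
  refine Subgroup.normalizer_inf_normalizer_le_normalizer_sup _ _ ⟨h1, ?_⟩
  rw [Subgroup.normalizer_eq_top]
  exact Subgroup.mem_top _

theorem radical_le_norm (G : Type u) [Group G] : 𝔥.radical G ≤ norm 𝔥 𝔣 G :=
  le_iInf fun _ => le_sup_right.trans Subgroup.le_normalizer

/-- The norm contains the radical. If that is trivial, it contains the centralizer of `G^𝔣`, since
`H^𝔣 ≤ G^𝔣` for all `H` by subgroup-closure; a nontrivial nilpotent `G^𝔣` has nontrivial centre. -/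
theorem norm_ne_bot (h𝔣 : 𝔣.IsFormation) (hS : 𝔣 = 𝔣.subgroupClosure) {G : Type u} [Group G]
    [Finite G] [Nontrivial G] (h : (fittingNilpotentProduct 𝔥 𝔣).Mem G) : norm 𝔥 𝔣 G ≠ ⊥ := by
  by_cases hrad : 𝔥.radical G = ⊥
  swap
  · exact ne_bot_of_le_ne_bot hrad (radical_le_norm G)
  have hnil := isNilpotent_residual_of_radical_eq_bot h𝔣 hrad h
  have hle : Subgroup.centralizer (𝔣.residual G : Set G) ≤ norm 𝔥 𝔣 G := by
    refine le_iInf fun H => ?_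
    rw [hrad, sup_bot_eq]
    exact (Subgroup.centralizer_le (h𝔣.map_subtype_residual_le hS H)).trans
      (Subgroup.centralizer_le_normalizer _)
  refine ne_bot_of_le_ne_bot ?_ hle
  by_cases hres : 𝔣.residual G = ⊥
  · have : Subgroup.centralizer (𝔣.residual G : Set G) = ⊤ := by
      rw [hres, Subgroup.centralizer_eq_top_iff_subset]
      simp
    rw [this]
    exact top_ne_bot
  · have : Nontrivial (𝔣.residual G) := (Subgroup.nontrivial_iff_ne_bot _).2 hres
    have hc : (Subgroup.center (𝔣.residual G)).map (𝔣.residual G).subtype ≠ ⊥ := by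
      rw [Ne, Subgroup.map_eq_bot_iff_of_injective _ (Subgroup.subtype_injective _)]
      exact Group.IsNilpotent.center_ne_bot _
    refine ne_bot_of_le_ne_bot hc ?_
    rintro _ ⟨z, hz, rfl⟩
    rw [Subgroup.mem_centralizer_iff]
    intro y hy
    exact congrArg Subtype.val (Subgroup.mem_center_iff.1 hz ⟨y, hy⟩)

end GroupClass

namespace GroupClass

variable {π : Set Nat.Primes} {𝔥 𝔣 : GroupClass.{u}}

/-! ### Groups whose quotient by the norm is in `H ◇ N ∘ F` -/

theorem isPGroup_of_hasLocalRadical (h_pi : piGroups πᶜ ≤ 𝔥) {G : Type u} [Group G] [Finite G]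
    (hrad : 𝔥.radical G = ⊥) {M : Subgroup G} [hMn : M.Normal]
    (hmin : ∀ A : Subgroup G, A.Normal → A ≠ ⊥ → M ≤ A) (h : HasLocalRadical π G) :
    ∃ q : ℕ, q.Prime ∧ IsPGroup q M := by
  rcases h with h | ⟨q, h⟩
  · exact absurd (le_bot_iff.1 (hrad ▸ le_radical inferInstance
      (h_pi _ ((piGroups_isFittingClass πᶜ).radical_mem G)))) h
  · refine ⟨q, q.2, (piGroups_singleton_mem_iff q M).1 ?_⟩
    exact (piGroups_isFittingClass {q}).mem_of_le hMn (hmin _ inferInstance h)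
      ((piGroups_isFittingClass {q}).radical_mem G)

theorem isMulCommutative_of_isPGroup {G : Type*} [Group G] [Finite G] {M : Subgroup G} [M.Normal]
    (hne : M ≠ ⊥) (hmin : ∀ A : Subgroup G, A.Normal → A ≠ ⊥ → M ≤ A) {q : ℕ} (hq : q.Prime)
    (hM : IsPGroup q M) : IsMulCommutative M := by
  have : Fact q.Prime := ⟨hq⟩
  have : Nontrivial M := (Subgroup.nontrivial_iff_ne_bot _).2 hne
  have hle := hmin ((Subgroup.center M).map M.subtype) inferInstance (by
    rw [Ne, Subgroup.map_eq_bot_iff_of_injective _ M.subtype_injective]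
    exact hM.bot_lt_center.ne')
  refine ⟨⟨fun a b => ?_⟩⟩
  obtain ⟨c, hc, hca⟩ := hle a.2
  obtain rfl : c = a := Subtype.ext hca
  exact (Subgroup.mem_center_iff.1 hc b).symm

/-- The Frattini case of the minimal counterexample; it is where saturation of `𝔥` is needed. -/
theorem mem_of_quotient_mem_of_le_frattini (h𝔥 : 𝔥.IsFormation) (h𝔥' : 𝔥.IsFittingClass)
    (hsat : 𝔥.IsSaturated) (h_pi : piGroups πᶜ ≤ 𝔥) (hE : 𝔥 = 𝔥.extensionClosure)
    (h𝔣 : 𝔣.IsFormation) {G : Type u} [Group G] [Finite G] (hrad : 𝔥.radical G = ⊥)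
    {M : Subgroup G} [M.Normal] (hne : M ≠ ⊥)
    (hmin : ∀ A : Subgroup G, A.Normal → A ≠ ⊥ → M ≤ A) (hM : M ≤ frattini G)
    (h : (fittingNilpotentProduct 𝔥 𝔣).Mem (G ⧸ M)) : (fittingNilpotentProduct 𝔥 𝔣).Mem G := by
  obtain ⟨q, hq, hMq⟩ : ∃ q : ℕ, q.Prime ∧ IsPGroup q M := by
    have : Nontrivial (frattini G) :=
      (Subgroup.nontrivial_iff_ne_bot _).2 (ne_bot_of_le_ne_bot hne hM)
    exact isPGroup_of_hasLocalRadical h_pi hrad hmin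
      ((hasLocalRadical_of_isNilpotent frattini_nilpotent).of_normal
        (N := frattini G) inferInstance (MulEquiv.refl _))
  have : Fact q.Prime := ⟨hq⟩
  have := isMulCommutative_of_isPGroup hne hmin hq hMq
  -- Otherwise all `q`-groups, in particular `M`, would be in `𝔥`, against the trivial radical of
  -- `G`.
  have hndvd : ¬ q ∣ Nat.card (𝔥.radical (G ⧸ M)) := fun hdvd => hne <| le_bot_iff.1 <|
    hrad ▸ le_radical inferInstance
      (mem_of_isPGroup_of_dvd h𝔥 h𝔥' hsat hE (h𝔥'.radical_mem _) hdvd M hMq)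
  set R := (𝔥.radical (G ⧸ M)).comap (QuotientGroup.mk' M) with hR
  have hMR : M ≤ R := by
    rw [hR]
    conv_lhs => rw [← QuotientGroup.ker_mk' M]
    exact Subgroup.ker_le_comap _ _
  have hRmap : R.map (QuotientGroup.mk' M) = 𝔥.radical (G ⧸ M) :=
    Subgroup.map_comap_eq_self_of_surjective (QuotientGroup.mk'_surjective M) _
  have hco : (Nat.card M).Coprime (M.relIndex R) := by
    have hrel : M.relIndex R = Nat.card (𝔥.radical (G ⧸ M)) := by
      conv_lhs => rw [← QuotientGroup.ker_mk' M, ← MonoidHom.comap_bot, Subgroup.relIndex_comap,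
        hRmap, Subgroup.relIndex_bot_left]
    rw [hrel]
    obtain ⟨n, hn⟩ := IsPGroup.iff_card.1 hMq
    rw [hn]
    exact ((Nat.Prime.coprime_iff_not_dvd hq).2 hndvd).pow_left n
  obtain ⟨L, hLn, hLM, hLR⟩ := exists_normal_complement_of_le_frattini hMR hM hco
  have hLmap : L.map (QuotientGroup.mk' M) = 𝔥.radical (G ⧸ M) := by
    rw [← hRmap, ← hLR, Subgroup.map_sup, (Subgroup.map_eq_bot_iff M).2
      (QuotientGroup.ker_mk' M).ge, sup_bot_eq]
  have hinj : Function.Injective ((QuotientGroup.mk' M).subgroupMap L) := by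
    rw [← MonoidHom.ker_eq_bot_iff, Subgroup.ker_subgroupMap, QuotientGroup.ker_mk',
      Subgroup.subgroupOf_eq_bot, disjoint_iff, inf_comm, hLM]
  have hLmem : 𝔥.Mem L := by
    refine 𝔥.mem_of_mulEquiv (MulEquiv.ofBijective _
      ⟨hinj, (QuotientGroup.mk' M).subgroupMap_surjective L⟩).symm ?_
    rw [hLmap]
    exact h𝔥'.radical_mem _
  have hLbot : L = ⊥ := le_bot_iff.1 (hrad ▸ le_radical hLn hLmem)
  have hradM : 𝔥.radical (G ⧸ M) = ⊥ := by rw [← hLmap, hLbot, Subgroup.map_bot]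
  have hnil := isNilpotent_residual_of_radical_eq_bot h𝔣 hradM h
  rw [← h𝔣.map_residual_of_surjective (QuotientGroup.mk' M) (QuotientGroup.mk'_surjective M)]
    at hnil
  exact mem_fittingNilpotentProduct_of_isNilpotent_residual h𝔥' h𝔣
    (isNilpotent_of_map_mk_of_le_frattini _ M hM hnil)

/-- If a minimal normal subgroup that normalizes the residuals of all subgroups is not in the
Frattini subgroup, it contains the residual of the group. -/
theorem residual_le_of_not_le_frattini (h𝔣 : 𝔣.IsFormation) {G : Type u} [Group G] [Finite G]
    {M : Subgroup G} [M.Normal] (hmin : ∀ A : Subgroup G, A.Normal → A ≠ ⊥ → M ≤ A)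
    (hnorm : ∀ H : Subgroup G,
      M ≤ Subgroup.normalizer ((𝔣.residual H).map H.subtype : Set G))
    (hM : ¬ M ≤ frattini G) : 𝔣.residual G ≤ M := by
  obtain ⟨H, hH, hMH⟩ : ∃ H : Subgroup G, IsCoatom H ∧ ¬ M ≤ H := by
    by_contra! hcon
    exact hM (le_iInf₂ hcon)
  have hsup : H ⊔ M = ⊤ := hH.2 _ (left_lt_sup.2 hMH)
  have hHn : H ≤ Subgroup.normalizer ((𝔣.residual H).map H.subtype : Set G) := by
    have := Subgroup.le_normalizer_map (H := 𝔣.residual H) H.subtype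
    rw [Subgroup.normalizer_eq_top, ← MonoidHom.range_eq_map, Subgroup.range_subtype] at this
    exact this
  have hn : ((𝔣.residual H).map H.subtype).Normal := by
    rw [← Subgroup.normalizer_eq_top_iff, eq_top_iff, ← hsup]
    exact sup_le hHn (hnorm H)
  -- A nontrivial normal subgroup would contain `M`, but this one lies in `H`.
  have hres : 𝔣.residual H = ⊥ := by
    by_contra hne
    refine hMH ((hmin _ hn ?_).trans (Subgroup.map_subtype_le _))
    rwa [Ne, Subgroup.map_eq_bot_iff_of_injective _ H.subtype_injective]
  have hHmem : 𝔣.Mem H := (h𝔣.residual_eq_bot_iff H).1 hres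
  have hsurj : Function.Surjective ((QuotientGroup.mk' M).comp H.subtype) := by
    rw [← MonoidHom.range_eq_top, MonoidHom.range_comp, Subgroup.range_subtype,
      ← Subgroup.map_top_of_surjective _ (QuotientGroup.mk'_surjective M), ← hsup,
      Subgroup.map_sup, (Subgroup.map_eq_bot_iff M).2 (QuotientGroup.ker_mk' M).ge, sup_bot_eq]
  have h := (h𝔣.mem_iff_residual_le_ker (QuotientGroup.mk' M)
    (QuotientGroup.mk'_surjective M)).1 (h𝔣.image _ hsurj hHmem)
  rwa [QuotientGroup.ker_mk'] at h

/-- For a critical subgroup `H`, the residual `H^𝔣` is nontrivial and `π`-nilpotent. It lies in `G^𝔣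
≤ M` and is normalized by `M`, so it is subnormal in `G`. -/
theorem hasLocalRadical_of_piBoundaryI (h𝔣 : 𝔣.IsFormation) (hS : 𝔣 = 𝔣.subgroupClosure)
    (hI : PiBoundaryI π 𝔣) {G : Type u} [Group G] [Finite G] (hG : ¬ 𝔣.Mem G)
    {M : Subgroup G} [hMn : M.Normal] (hres : 𝔣.residual G ≤ M)
    (hnorm : ∀ H : Subgroup G,
      M ≤ Subgroup.normalizer ((𝔣.residual H).map H.subtype : Set G)) :
    HasLocalRadical π G := by
  obtain ⟨H, hH⟩ := exists_critical_subgroup hG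
  have hnil : (piNilpotentGroups π).Mem (𝔣.residual H) := (hI H hH).2
  have hne : 𝔣.residual H ≠ ⊥ := fun h => hH.2.1 ((h𝔣.residual_eq_bot_iff H).1 h)
  have : Nontrivial (𝔣.residual H) := (Subgroup.nontrivial_iff_ne_bot _).2 hne
  have hle : (𝔣.residual H).map H.subtype ≤ M := (h𝔣.map_subtype_residual_le hS H).trans hres
  have hsub : (((𝔣.residual H).map H.subtype).subgroupOf M).Normal :=
    (Subgroup.normal_subgroupOf_iff_le_normalizer hle).2 (hnorm H)
  have e : 𝔣.residual H ≃* ((𝔣.residual H).map H.subtype).subgroupOf M :=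
    ((𝔣.residual H).equivMapOfInjective _ H.subtype_injective).trans
      (Subgroup.subgroupOfEquivOfLe hle).symm
  exact ((hasLocalRadical_of_piNilpotentGroups hnil).of_normal hsub e).of_normal hMn
    (MulEquiv.refl _)

theorem piSolvableGroups_mem_residual_quotient {X : GroupClass.{u}} (hX : X.IsFormation)
    {G : Type u} [Group G] [Finite G] (A : Subgroup G) [A.Normal]
    (h : (piSolvableGroups π).Mem (X.residual G)) :
    (piSolvableGroups π).Mem (X.residual (G ⧸ A)) := by
  rw [← hX.map_residual_of_surjective (QuotientGroup.mk' A) (QuotientGroup.mk'_surjective A)]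
  exact piSolvableGroups_image _ ((QuotientGroup.mk' A).subgroupMap_surjective _) h

theorem mem_of_quotient_norm_mem (h𝔥 : 𝔥.IsFormation) (h𝔥' : 𝔥.IsFittingClass)
    (hsat : 𝔥.IsSaturated) (h_pi : piGroups πᶜ ≤ 𝔥) (hE : 𝔥 = 𝔥.extensionClosure)
    (h𝔣 : 𝔣.IsFormation) (hS : 𝔣 = 𝔣.subgroupClosure) (G : Type u) [Group G] [Finite G]
    (hcond : (piSolvableGroups π).Mem ((fittingNilpotentProduct 𝔥 𝔣).residual G) ∨
      PiBoundaryI π 𝔣)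
    (h : (fittingNilpotentProduct 𝔥 𝔣).Mem (G ⧸ norm 𝔥 𝔣 G)) :
    (fittingNilpotentProduct 𝔥 𝔣).Mem G := by
  have hX := fittingNilpotentProduct_isFormation h𝔥 h𝔥' h𝔣
  induction hn : Nat.card G using Nat.strong_induction_on generalizing G with
  | _ n ih =>
  by_contra hG
  -- All hypotheses pass to `G ⧸ A`, the one on the norm because the norm of `G` maps into that of
  -- `G ⧸ A`.
  have hquot : ∀ A : Subgroup G, ∀ _ : A.Normal, A ≠ ⊥ →
      (fittingNilpotentProduct 𝔥 𝔣).Mem (G ⧸ A) := by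
    intro A hA hne
    refine ih _ ?_ (G ⧸ A) ?_ ?_ rfl
    · rw [← hn, ← A.card_mul_index, ← Subgroup.index_eq_card]
      exact lt_mul_of_one_lt_left (Nat.pos_of_ne_zero A.index_ne_zero_of_finite)
        (A.one_lt_card_iff_ne_bot.2 hne)
    · exact hcond.imp_left (piSolvableGroups_mem_residual_quotient hX A)
    · refine hX.mem_of_ker_le (QuotientGroup.mk' (norm 𝔥 𝔣 G))
        ((QuotientGroup.mk' (norm 𝔥 𝔣 (G ⧸ A))).comp (QuotientGroup.mk' A))
        (QuotientGroup.mk'_surjective _)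
        ((QuotientGroup.mk'_surjective _).comp (QuotientGroup.mk'_surjective _)) ?_ h
      rw [← MonoidHom.comap_ker, QuotientGroup.ker_mk', QuotientGroup.ker_mk',
        ← Subgroup.map_le_iff_le_comap]
      exact map_norm_le h𝔥 h𝔥' h𝔣 _ (QuotientGroup.mk'_surjective A)
  have hrad : 𝔥.radical G = ⊥ := by
    by_contra hne
    exact hG (fittingNilpotentProduct_mem_of_extension h𝔥' hE h𝔣 _ (h𝔥'.radical_mem G)
      (hquot _ inferInstance hne))
  have hN : norm 𝔥 𝔣 G ≠ ⊥ := by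
    intro hbot
    exact hG (GroupClass.mem_of_mulEquiv _
      ((QuotientGroup.quotientMulEquivOfEq hbot).trans QuotientGroup.quotientBot) h)
  obtain ⟨M, ⟨hMn, hMne, hMle⟩, hMmin⟩ := Set.Finite.exists_minimal
    (Set.toFinite {M : Subgroup G | M.Normal ∧ M ≠ ⊥ ∧ M ≤ norm 𝔥 𝔣 G})
    ⟨_, inferInstance, hN, le_rfl⟩
  -- If `A ∩ M = 1`, then `G` is a subdirect product of two proper quotients, both in the class.
  have hmin : ∀ A : Subgroup G, A.Normal → A ≠ ⊥ → M ≤ A := by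
    intro A hA hne
    by_cases hAM : A ⊓ M = ⊥
    · refine absurd (hX.mem_of_ker_inf_le (QuotientGroup.mk' A) (QuotientGroup.mk' M)
        (MonoidHom.id G) (QuotientGroup.mk'_surjective A) (QuotientGroup.mk'_surjective M)
        Function.surjective_id ?_ (hquot A hA hne) (hquot M hMn hMne)) hG
      rw [QuotientGroup.ker_mk', QuotientGroup.ker_mk', hAM]
      exact bot_le
    · exact (hMmin (y := A ⊓ M) ⟨inferInstance, hAM, inf_le_right.trans hMle⟩
        inf_le_right).trans inf_le_left
  have hnorm : ∀ H : Subgroup G,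
      M ≤ Subgroup.normalizer ((𝔣.residual H).map H.subtype : Set G) := by
    intro H
    refine hMle.trans ((iInf_le _ H).trans ?_)
    rw [hrad, sup_bot_eq]
  by_cases hfr : M ≤ frattini G
  · exact hG (mem_of_quotient_mem_of_le_frattini h𝔥 h𝔥' hsat h_pi hE h𝔣 hrad hMne hmin hfr
      (hquot M hMn hMne))
  have hres : 𝔣.residual G ≤ M := residual_le_of_not_le_frattini h𝔣 hmin hnorm hfr
  have hloc : HasLocalRadical π G := by
    rcases hcond with hc | hc
    · have : Nontrivial ((fittingNilpotentProduct 𝔥 𝔣).residual G) :=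
        (Subgroup.nontrivial_iff_ne_bot _).2 fun hbot => hG ((hX.residual_eq_bot_iff G).1 hbot)
      exact (hasLocalRadical_of_piSolvableGroups hc).of_normal
        (N := (fittingNilpotentProduct 𝔥 𝔣).residual G) inferInstance (MulEquiv.refl _)
    · refine hasLocalRadical_of_piBoundaryI h𝔣 hS hc (fun hmem => hG ?_) hres hnorm
      refine mem_fittingNilpotentProduct_of_isNilpotent_residual h𝔥' h𝔣 ?_
      rw [(h𝔣.residual_eq_bot_iff G).2 hmem]
      infer_instance
  obtain ⟨q, hq, hMq⟩ := isPGroup_of_hasLocalRadical h_pi hrad hmin hloc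
  have : Fact q.Prime := ⟨hq⟩
  exact hG (mem_fittingNilpotentProduct_of_isNilpotent_residual h𝔥' h𝔣
    (hMq.to_le hres).isNilpotent)

/-! ### The norm series -/

theorem normSeries_succ (𝔥 𝔣 : GroupClass.{u}) (G : Type u) [Group G] (i : ℕ) :
    normSeries 𝔥 𝔣 G (i + 1) = (norm 𝔥 𝔣 (G ⧸ normSeries 𝔥 𝔣 G i)).comap
      (QuotientGroup.mk' (normSeries 𝔥 𝔣 G i)) :=
  rfl

theorem normSeries_le_succ (𝔥 𝔣 : GroupClass.{u}) (G : Type u) [Group G] (i : ℕ) :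
    normSeries 𝔥 𝔣 G i ≤ normSeries 𝔥 𝔣 G (i + 1) := by
  rw [normSeries_succ]
  conv_lhs => rw [← QuotientGroup.ker_mk' (normSeries 𝔥 𝔣 G i)]
  exact Subgroup.ker_le_comap _ _

theorem exists_normInfty_eq_normSeries (𝔥 𝔣 : GroupClass.{u}) (G : Type u) [Group G] [Finite G] :
    ∃ n, normInfty 𝔥 𝔣 G = normSeries 𝔥 𝔣 G n := by
  have hmono : Monotone (normSeries 𝔥 𝔣 G) :=
    monotone_nat_of_le_succ (normSeries_le_succ 𝔥 𝔣 G)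
  obtain ⟨n, hn⟩ := WellFoundedGT.monotone_chain_condition ⟨normSeries 𝔥 𝔣 G, hmono⟩
  refine ⟨n, le_antisymm (iSup_le fun m => ?_) (le_iSup _ n)⟩
  rcases le_total n m with h | h
  · exact (hn m h).ge
  · exact hmono h

theorem norm_quotient_normInfty (𝔥 𝔣 : GroupClass.{u}) (G : Type u) [Group G] [Finite G] :
    norm 𝔥 𝔣 (G ⧸ normInfty 𝔥 𝔣 G) = ⊥ := by
  obtain ⟨n, hn⟩ := exists_normInfty_eq_normSeries 𝔥 𝔣 G
  -- Stated for a variable `N` so that the equation with the stationary term can be substituted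
  -- inside the quotient type.
  have key : ∀ (N : Subgroup G) (_ : N.Normal), N = normSeries 𝔥 𝔣 G n →
      normSeries 𝔥 𝔣 G (n + 1) ≤ N → norm 𝔥 𝔣 (G ⧸ N) = ⊥ := by
    rintro N _ rfl hle
    rw [normSeries_succ] at hle
    rw [← Subgroup.map_comap_eq_self_of_surjective (QuotientGroup.mk'_surjective
      (normSeries 𝔥 𝔣 G n)) (norm 𝔥 𝔣 (G ⧸ normSeries 𝔥 𝔣 G n)), Subgroup.map_eq_bot_iff,
      QuotientGroup.ker_mk']
    exact hle
  exact key _ inferInstance hn (le_iSup (normSeries 𝔥 𝔣 G) (n + 1))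

theorem norm_le_normInfty (h𝔥 : 𝔥.IsFormation) (h𝔥' : 𝔥.IsFittingClass) (h𝔣 : 𝔣.IsFormation)
    (G : Type u) [Group G] [Finite G] : norm 𝔥 𝔣 G ≤ normInfty 𝔥 𝔣 G := by
  refine le_trans ?_ (le_iSup (normSeries 𝔥 𝔣 G) 1)
  -- The first term is the preimage of the norm of `G ⧸ ⊥`, so the projection onto this quotient has
  -- to be taken into account.
  rw [normSeries_succ, ← Subgroup.map_le_iff_le_comap]
  exact map_norm_le h𝔥 h𝔥' h𝔣 _ (QuotientGroup.mk'_surjective _)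

/-- Descend along the series from the trivial quotient `G ⧸ ⊤`: the quotient by term `i + 1` is the
quotient by term `i` modulo its norm. -/
theorem mem_of_normInfty_eq_top (h𝔥 : 𝔥.IsFormation) (h𝔥' : 𝔥.IsFittingClass)
    (hsat : 𝔥.IsSaturated) (h_pi : piGroups πᶜ ≤ 𝔥) (hE : 𝔥 = 𝔥.extensionClosure)
    (h𝔣 : 𝔣.IsFormation) (hS : 𝔣 = 𝔣.subgroupClosure) (G : Type u) [Group G] [Finite G]
    (hcond : (piSolvableGroups π).Mem ((fittingNilpotentProduct 𝔥 𝔣).residual G) ∨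
      PiBoundaryI π 𝔣)
    (h : normInfty 𝔥 𝔣 G = ⊤) : (fittingNilpotentProduct 𝔥 𝔣).Mem G := by
  have hX := fittingNilpotentProduct_isFormation h𝔥 h𝔥' h𝔣
  obtain ⟨n, hn⟩ := exists_normInfty_eq_normSeries 𝔥 𝔣 G
  rw [h] at hn
  have key : ∀ i ≤ n, (fittingNilpotentProduct 𝔥 𝔣).Mem (G ⧸ normSeries 𝔥 𝔣 G i) := by
    intro i hi
    induction hi using Nat.decreasingInduction with
    | self =>
      have := QuotientGroup.subsingleton_quotient_top (G := G)
      exact GroupClass.mem_of_mulEquiv _ (QuotientGroup.quotientMulEquivOfEq hn)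
        (hX.mem_of_subsingleton _)
    | of_succ i hi ih =>
      refine mem_of_quotient_norm_mem h𝔥 h𝔥' hsat h_pi hE h𝔣 hS _
        (hcond.imp_left (piSolvableGroups_mem_residual_quotient hX _)) ?_
      refine hX.mem_of_ker_le (QuotientGroup.mk' (normSeries 𝔥 𝔣 G (i + 1)))
        ((QuotientGroup.mk' (norm 𝔥 𝔣 (G ⧸ normSeries 𝔥 𝔣 G i))).comp
          (QuotientGroup.mk' (normSeries 𝔥 𝔣 G i)))
        (QuotientGroup.mk'_surjective _)
        ((QuotientGroup.mk'_surjective _).comp (QuotientGroup.mk'_surjective _)) ?_ ih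
      rw [← MonoidHom.comap_ker, QuotientGroup.ker_mk', QuotientGroup.ker_mk', normSeries_succ]
  exact GroupClass.mem_of_mulEquiv _ QuotientGroup.quotientBot (key 0 (Nat.zero_le n))

end GroupClass

/-! ### The equivalences -/

theorem theoremA (π : Set Nat.Primes) (𝔥 𝔣 : GroupClass.{u})
    (h_formation : 𝔥.IsFormation) (h_fitting : 𝔥.IsFittingClass) (h_saturated : 𝔥.IsSaturated)
    (h_pi : GroupClass.piGroups πᶜ ≤ 𝔥) (h_ext : 𝔥 = 𝔥.extensionClosure)
    (f_formation : 𝔣.IsFormation) (f_sub : 𝔣 = 𝔣.subgroupClosure)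
    (G : Type u) [Group G] [Finite G]
    (h_cond : (GroupClass.piSolvableGroups π).Mem
        ((GroupClass.fittingNilpotentProduct 𝔥 𝔣).residual G) ∨ GroupClass.PiBoundaryI π 𝔣) :
    List.TFAE [
      (GroupClass.fittingNilpotentProduct 𝔥 𝔣).Mem G,
      (GroupClass.fittingNilpotentProduct 𝔥 𝔣).Mem (G ⧸ GroupClass.norm 𝔥 𝔣 G),
      (GroupClass.fittingNilpotentProduct 𝔥 𝔣).Mem (G ⧸ GroupClass.normInfty 𝔥 𝔣 G),
      ∀ (N : Subgroup G) [N.Normal], N ≠ ⊤ → GroupClass.norm 𝔥 𝔣 (G ⧸ N) ≠ ⊥,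
      GroupClass.normInfty 𝔥 𝔣 G = ⊤] := by
  have hX := GroupClass.fittingNilpotentProduct_isFormation h_formation h_fitting f_formation
  tfae_have 1 → 2 := fun h => hX.image _ (QuotientGroup.mk'_surjective _) h
  tfae_have 2 → 3 := by
    intro h
    refine hX.mem_of_ker_le (QuotientGroup.mk' (GroupClass.norm 𝔥 𝔣 G))
      (QuotientGroup.mk' (GroupClass.normInfty 𝔥 𝔣 G)) (QuotientGroup.mk'_surjective _)
      (QuotientGroup.mk'_surjective _) ?_ h
    rw [QuotientGroup.ker_mk', QuotientGroup.ker_mk']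
    exact GroupClass.norm_le_normInfty h_formation h_fitting f_formation G
  tfae_have 3 → 5 := by
    intro h
    by_contra hne
    have : Nontrivial (G ⧸ GroupClass.normInfty 𝔥 𝔣 G) :=
      QuotientGroup.nontrivial_iff.2 hne
    exact GroupClass.norm_ne_bot f_formation f_sub h (GroupClass.norm_quotient_normInfty 𝔥 𝔣 G)
  tfae_have 5 → 1 := GroupClass.mem_of_normInfty_eq_top h_formation h_fitting h_saturated h_pi
    h_ext f_formation f_sub G h_cond
  tfae_have 1 → 4 := by
    intro h N _ hne
    have : Nontrivial (G ⧸ N) := QuotientGroup.nontrivial_iff.2 hne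
    exact GroupClass.norm_ne_bot f_formation f_sub
      (hX.image _ (QuotientGroup.mk'_surjective N) h)
  tfae_have 4 → 5 := by
    intro h
    by_contra hne
    exact h _ hne (GroupClass.norm_quotient_normInfty 𝔥 𝔣 G)
  tfae_finish
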